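/- Let $d\ge 1$, let $\Omega\subset\mathbb{R}^d$ be a bounded open set (for instance a bounded Lipschitz domain), let $H^1_0(\Omega)$ be the closure of $C_c^\infty(\Omega)$ in the $H^1$ norm, let $T>0$, $I=(0,T)$ and $\alpha>0$. Let $a_{ij}\in L^\infty(I\times\Omega)$, $1\le i,j\le d$, satisfy $a_{ij}=a_{ji}$ and $\sum_{i,j}a_{ij}(t,x)\xi_i\xi_j\ge\alpha|\xi|^2$ for all $\xi\in\mathbb{R}^d$ and a.e. $(t,x)\in I\times\Omega$. Let $a_{ij}(\cdot,x)$ be continuous on $[0,T]$ for a.e. $x\in\Omega$, with $$|a_{ij}(t_1,x)-a_{ij}(t_2,x)|\le\omega(|t_1-t_2|)\quad\text{for all }t_1,t_2\in[0,T]\text{ and a.e. }x\in\Omega,$$ where $\omega:[0,T]\to[0,\infty)$ is nondecreasing, $\omega(t)/t^{3/2}$ is nonincreasing on $(0,T]$ and $\int_0^T\omega(t)t^{-3/2}\,dt<\infty$. Put $a(t;u,v)=\int_\Omega\sum_{i,j}a_{ij}(t,x)\,\partial_iu\,\partial_jv\,dx$ for $u,v\in H^1_0(\Omega)$, and let $A(t):H^1_0(\Omega)\to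 H^{-1}(\Omega)$ be given by $\langle A(t)u,v\rangle=a(t;u,v)$. Let constants $c,\beta,\kappa>0$ be given. For a mesh $0=t_0<t_1<\dots<t_M=T$ let $I_m=(t_{m-1},t_m]$, $k_m=t_m-t_{m-1}$, $k=\max_mk_m$, $k_{\min}=\min_mk_m$ and $A_{k,m}=\frac1{k_m}\int_{I_m}A(t)\,dt$. Call the mesh admissible if $k_{\min}\ge ck^\beta$, $\kappa^{-1}\le k_m/k_{m+1}\le\kappa$ for $1\le m\le M-1$, and $k\le T/4$. Let $X_k^0$ be the space of functions on $I$ that are constant in time on each $I_m$, with values $u_{k,m}\in H^1_0(\Omega)$. For $u_0\in L^2(\Omega)$ and $f\in L^\infty(I;L^2(\Omega))$ a function $u_k\in X_k^0$ is the dG(0) semidiscrete solution if, for all $\varphi_k\in X_k^0$, $$\int_Ia(t;u_k(t),\varphi_k(t))\,dt+\sum_{m=2}^M(u_{k,m}-u_{k,m-1},\varphi_{k,m})_{L^2(\Omega)}+(u_{k,1},\varphi_{k,1})_{L^2(\Omega)}=\int_I(f(t),\varphi_k(t))_{L^2(\Omega)}\,dt+(u_0,\varphi_{k,1})_{L^2(\Omega)}.$$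 Write $[u_k]_{m-1}=u_{k,m}-u_{k,m-1}$ for $m\ge2$ and $[u_k]_0=u_{k,1}-u_0$. **Theorem (discrete maximal parabolic regularity for $p=\infty$).** There are constants $\mu>0$, $\delta_0>0$ and $C>0$, independent of the mesh, of $f$ and of $u_0$, such that for every admissible mesh with $k-k_{\min}\le\delta_0$, every $f\in L^\infty(I;L^2(\Omega))$, every $u_0\in H^1_0(\Omega)$ with $A_{k,m}u_0\in L^2(\Omega)$ for $m=1,\dots,M$, and the corresponding dG(0) semidiscrete solution $u_k$, one has $A_{k,m}u_{k,m}\in L^2(\Omega)$ for $m=1,\dots,M$ and $$\max_{1\le m\le M}\left(\|A_{k,m}u_{k,m}\|_{L^2(\Omega)}+\left\|\frac{[u_k]_{m-1}}{k_m}\right\|_{L^2(\Omega)}\right)\le Ce^{\mu T}\left(\ln\frac Tk\,\|f\|_{L^\infty(I;L^2(\Omega))}+\mu T\max_{1\le m\le M}\|A_{k,m}u_0\|_{L^2(\Omega)}\right).$$ -/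

import Mathlib

open MeasureTheory Set
open scoped ENNReal

noncomputable section

namespace DG0

/-- Euclidean space `ℝ^d`. -/
abbrev E (d : ℕ) : Type := EuclideanSpace ℝ (Fin d)

/-- The real Hilbert space `L²(Ω)`. -/
abbrev L2 {d : ℕ} (Ω : Set (E d)) : Type := Lp ℝ 2 (volume.restrict Ω)

/-- The Hilbert space `L²(Ω) × L²(Ω)^d` of pairs (function, candidate gradient), with the
`ℓ²`-combination of the `L²` norms; restricted to pairs `(u, ∇u)` this is the `H¹` norm. -/
abbrev Pair {d : ℕ} (Ω : Set (E d)) : Type :=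
  WithLp 2 (L2 Ω × PiLp 2 (fun _ : Fin d => L2 Ω))

/-- The pairs `(φ, ∇φ)` with `φ ∈ C_c^∞(Ω)`. -/
def testPairs {d : ℕ} (Ω : Set (E d)) : Set (Pair Ω) :=
  {p | ∃ φ : E d → ℝ, ContDiff ℝ (⊤ : ℕ∞) φ ∧ HasCompactSupport φ ∧ tsupport φ ⊆ Ω ∧
    (p.fst : E d → ℝ) =ᵐ[volume.restrict Ω] φ ∧
    ∀ i : Fin d, (p.snd i : E d → ℝ) =ᵐ[volume.restrict Ω]
      fun x => fderiv ℝ φ x (EuclideanSpace.single i 1)}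

/-- The Sobolev space `H¹₀(Ω)`: the closure of `C_c^∞(Ω)` in the `H¹` norm. An element `u` is
stored together with its weak gradient (which it determines); the norm is the `H¹(Ω)` norm. -/
def H10 {d : ℕ} (Ω : Set (E d)) : Submodule ℝ (Pair Ω) :=
  (Submodule.span ℝ (testPairs Ω)).topologicalClosure

/-- The inclusion `H¹₀(Ω) ↪ L²(Ω)`. -/
def val {d : ℕ} {Ω : Set (E d)} (u : H10 Ω) : L2 Ω := (u : Pair Ω).fst

/-- The weak partial derivative `∂_i u ∈ L²(Ω)` of `u ∈ H¹₀(Ω)`. -/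
def pd {d : ℕ} {Ω : Set (E d)} (i : Fin d) (u : H10 Ω) : L2 Ω := (u : Pair Ω).snd i

/-- The conditions on the modulus of continuity `ω : [0,T] → [0,∞)`. -/
structure IsModulus (T : ℝ) (ω : ℝ → ℝ) : Prop where
  nonneg : ∀ s ∈ Icc 0 T, 0 ≤ ω s
  mono : MonotoneOn ω (Icc 0 T)
  anti : AntitoneOn (fun s => ω s / s ^ (3 / 2 : ℝ)) (Ioc 0 T)
  integrable : IntegrableOn (fun s => ω s / s ^ (3 / 2 : ℝ)) (Ioc 0 T)

/-- The conditions on the coefficients `a i j t x`: they lie in `L^∞(I × Ω)` with `I = (0,T)`, are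
symmetric and uniformly elliptic with constant `α`, are continuous in time on `[0,T]` for almost
every `x`, and have modulus of continuity `ω` in time. -/
structure IsCoeff {d : ℕ} (Ω : Set (E d)) (T α : ℝ) (ω : ℝ → ℝ)
    (a : Fin d → Fin d → ℝ → E d → ℝ) : Prop where
  bounded : ∀ i j, MemLp (fun p : ℝ × E d => a i j p.1 p.2) ∞
    ((volume.restrict (Ioo 0 T)).prod (volume.restrict Ω))
  symm : ∀ i j, ∀ᵐ p ∂((volume.restrict (Ioo 0 T)).prod (volume.restrict Ω)),
    a i j p.1 p.2 = a j i p.1 p.2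
  elliptic : ∀ᵐ p ∂((volume.restrict (Ioo 0 T)).prod (volume.restrict Ω)),
    ∀ ξ : E d, α * ‖ξ‖ ^ 2 ≤ ∑ i, ∑ j, a i j p.1 p.2 * ξ i * ξ j
  continuous : ∀ i j, ∀ᵐ x ∂(volume.restrict Ω), ContinuousOn (fun t => a i j t x) (Icc 0 T)
  modulus : ∀ i j, ∀ t₁ ∈ Icc 0 T, ∀ t₂ ∈ Icc 0 T, ∀ᵐ x ∂(volume.restrict Ω),
    |a i j t₁ x - a i j t₂ x| ≤ ω |t₁ - t₂|

/-- The bilinear form `a(t;u,v) = ∫_Ω ∑_{i,j} a_{ij}(t,x) ∂_i u ∂_j v dx = ⟨A(t)u, v⟩`. -/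
def form {d : ℕ} {Ω : Set (E d)} (a : Fin d → Fin d → ℝ → E d → ℝ) (t : ℝ) (u v : H10 Ω) : ℝ :=
  ∫ x in Ω, ∑ i, ∑ j, a i j t x * pd i u x * pd j v x

/-- A partition `0 = t_0 < t_1 < ⋯ < t_M = T`; only the values `t 0, …, t M` matter. -/
structure Mesh (T : ℝ) where
  M : ℕ
  M_pos : 1 ≤ M
  t : ℕ → ℝ
  t_zero : t 0 = 0
  t_last : t M = T
  t_lt : ∀ m < M, t m < t (m + 1)

namespace Mesh

variable {T : ℝ} (τ : Mesh T)

/-- The length `k_m = t_m - t_{m-1}` of `I_m = (t_{m-1}, t_m]`, for `1 ≤ m ≤ M`. -/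
def step (m : ℕ) : ℝ := τ.t m - τ.t (m - 1)

/-- `max_{1 ≤ m ≤ M} g m`. -/
def maxOver (g : ℕ → ℝ) : ℝ :=
  (Finset.Icc 1 τ.M).sup' (Finset.nonempty_Icc.mpr τ.M_pos) g

/-- The maximal time step `k`. -/
def k : ℝ := τ.maxOver τ.step

/-- The minimal time step `k_min`. -/
def kmin : ℝ := (Finset.Icc 1 τ.M).inf' (Finset.nonempty_Icc.mpr τ.M_pos) τ.step

/-- The standing conditions on the mesh, with constants `c, β, κ`. -/
structure Admissible (c β κ : ℝ) : Prop where
  min_ge : c * τ.k ^ β ≤ τ.kmin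
  ratio : ∀ m ∈ Finset.Icc 1 (τ.M - 1),
    κ⁻¹ ≤ τ.step m / τ.step (m + 1) ∧ τ.step m / τ.step (m + 1) ≤ κ
  le_quarter : τ.k ≤ T / 4

end Mesh

section Discretization

variable {d : ℕ} {Ω : Set (E d)} {T : ℝ}

/-- The duality pairing `⟨A_{k,m} u, v⟩`, where `A_{k,m} = k_m⁻¹ ∫_{I_m} A(t) dt` maps `H¹₀(Ω)` to
`H⁻¹(Ω)`. -/
def avgA (τ : Mesh T) (a : Fin d → Fin d → ℝ → E d → ℝ) (m : ℕ) (u v : H10 Ω) : ℝ :=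
  (τ.step m)⁻¹ * ∫ t in (τ.t (m - 1))..(τ.t m), form a t u v

/-- `A_{k,m} u ∈ L²(Ω)`, with `A_{k,m} u = g`: the functional `A_{k,m} u` on `H¹₀(Ω)` is the
`L²(Ω)` inner product with `g`. -/
def AvgAEq (τ : Mesh T) (a : Fin d → Fin d → ℝ → E d → ℝ) (m : ℕ) (u : H10 Ω) (g : L2 Ω) : Prop :=
  ∀ v : H10 Ω, avgA τ a m u v = inner ℝ g (val v)

/-- The bilinear form `B(u_k, φ_k)` on the space `X_k^0` of piecewise constant functions in time
with values in `H¹₀(Ω)`. Such a function is given by its values `u 1, …, u M` on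
`I_1, …, I_M`; other values of the sequence play no role. -/
def B (τ : Mesh T) (a : Fin d → Fin d → ℝ → E d → ℝ) (u φ : ℕ → H10 Ω) : ℝ :=
  (∑ m ∈ Finset.Icc 1 τ.M, ∫ t in (τ.t (m - 1))..(τ.t m), form a t (u m) (φ m))
    + (∑ m ∈ Finset.Icc 2 τ.M, inner ℝ (val (u m) - val (u (m - 1))) (val (φ m)))
    + inner ℝ (val (u 1)) (val (φ 1))

/-- `u` is the dG(0) semidiscrete solution: `B(u_k, φ_k) = (f, φ_k)_{I × Ω} + (u₀, φ_{k,1})_Ω` for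
all `φ_k ∈ X_k^0`. -/
def IsSolution (τ : Mesh T) (a : Fin d → Fin d → ℝ → E d → ℝ) (f : ℝ → L2 Ω) (u₀ : L2 Ω)
    (u : ℕ → H10 Ω) : Prop :=
  ∀ φ : ℕ → H10 Ω, B τ a u φ =
    (∑ m ∈ Finset.Icc 1 τ.M, ∫ t in (τ.t (m - 1))..(τ.t m), inner ℝ (f t) (val (φ m)))
      + inner ℝ u₀ (val (φ 1))

/-- The jump `[u_k]_{m-1} = u_{k,m} - u_{k,m-1}` for `m ≥ 2`, and `[u_k]_0 = u_{k,1} - u₀`. -/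
def jumpBefore (u₀ : L2 Ω) (u : ℕ → H10 Ω) (m : ℕ) : L2 Ω :=
  val (u m) - if m = 1 then u₀ else val (u (m - 1))

end Discretization

end DG0

end

/-! The proof freezes the operator at the final interval and argues by duality. Fix `m`, write `A =
A_{k,m}` and `h = A u_m`, and let the backward products of resolvents `z_i = ∏_{l ≤ i} (1 + k_l A)⁻¹
h` (steps counted back from `I_m`) act as test functions. Summation by parts gives a discrete
Duhamel formula for `‖h‖²` with three terms: the initial value, the data `∑ k_i (f_i, A z_i)`, and
the perturbation caused by replacing `A_{k,j}` by `A` (`IsResolventChain.duhamel`).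

The smoothing estimates come from expanding `h = ∏ (1 + k_l A) z_i`. Since `A` is symmetric and
positive, the terms `A^p z_i` have nonnegative inner products with each other, so each of the terms
of order 0, 1, 2 is bounded by `‖h‖`. With `s = ∑ k_l` this gives `‖A z_i‖ ≤ ‖h‖ / s` and `e₂ ‖A²
z_i‖ ≤ ‖h‖`, where `e₂` is comparable to `s²` because neighbouring steps are comparable.
Interpolating, `‖A z_i‖_{H¹} ≤ C s^{-3/2} ‖h‖`. No spectral calculus is needed.

The data term then costs `∑ k_i / s_i ≤ 1 + ln (T / k_min)`, which admissibility compares with `ln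
(T / k)`. The perturbation term costs `∑ k_i ω(s_i) s_i^{-3/2} max ‖u_j‖_{H¹}`, and the sum is at
most the integral of `ω(s) s^{-3/2}`. Finally `‖u_j‖_{H¹} ≤ ε ‖A_{k,j} u_j‖ + C_ε ‖u_j‖`: the first
part is absorbed into the maximum of the left-hand side, and the second is controlled by the energy
estimate. The jumps follow from the scheme. -/

noncomputable section

namespace DG0

/-! ### Smoothing estimates for products of resolvents. -/

section Abstract

variable {V H : Type*} [NormedAddCommGroup V] [InnerProductSpace ℝ V]
  [NormedAddCommGroup H] [InnerProductSpace ℝ H]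

/-- This replaces the spectral theorem: terms with nonnegative inner products can be dropped from a
sum without increasing its norm. -/
theorem norm_le_norm_add_of_inner_nonneg {p q : H} (h : 0 ≤ inner ℝ p q) : ‖p‖ ≤ ‖p + q‖ := by
  have := norm_add_sq_real p q
  nlinarith [sq_nonneg ‖q‖, norm_nonneg p, norm_nonneg (p + q)]

/-- Solvability of `ι* ι z + k b z = ι* h` for a coercive form `b`. -/
theorem exists_resolvent [CompleteSpace V] (ι : V →L[ℝ] H) (b : V →L[ℝ] V →L[ℝ] ℝ) {α : ℝ}
    (hα : 0 < α) (hb : ∀ u, α * ‖u‖ ^ 2 ≤ b u u) {k : ℝ} (hk : 0 < k) (h : H) :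
    ∃ z : V, ∀ v, inner ℝ (ι z) (ι v) + k * b z v = inner ℝ h (ι v) := by
  let I : H →L[ℝ] H →L[ℝ] ℝ := innerSL ℝ
  let F : V →L[ℝ] V →L[ℝ] ℝ := k • b + I.bilinearComp ι ι
  have hF : ∀ u v, F u v = inner ℝ (ι u) (ι v) + k * b u v := fun u v => by
    rw [add_comm]; rfl
  have hc : IsCoercive F := by
    refine ⟨k * α, by positivity, fun u => ?_⟩
    rw [hF]
    have h1 := mul_le_mul_of_nonneg_left (hb u) hk.le
    have h2 : (0 : ℝ) ≤ inner ℝ (ι u) (ι u) := real_inner_self_nonneg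
    nlinarith
  let ℓ : V →L[ℝ] ℝ := (innerSL ℝ h).comp ι
  refine ⟨hc.continuousLinearEquivOfBilin.symm ((InnerProductSpace.toDual ℝ V).symm ℓ),
    fun v => ?_⟩
  rw [← hF, ← hc.continuousLinearEquivOfBilin_apply, ContinuousLinearEquiv.apply_symm_apply,
    InnerProductSpace.toDual_symm_apply]
  simp [ℓ]

/-- The sequence `z i = ∏_{l ≤ i} (1 + k l A)⁻¹ h` for the operator `A` of the form `b`, together
with `y i = A (z i) ∈ H`, the lift `Y i ∈ V` of `y (i + 1)`, and `x i = A (Y i) ∈ H`. -/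
structure IsResolventChain (ι : V →L[ℝ] H) (b : V →L[ℝ] V →L[ℝ] ℝ) (k : ℕ → ℝ) (h : H)
    (z : ℕ → V) (y : ℕ → H) (Y : ℕ → V) (x : ℕ → H) : Prop where
  z_zero : ι (z 0) + k 0 • y 0 = h
  z_succ : ∀ i, z i = z (i + 1) + k (i + 1) • Y i
  y_spec : ∀ i v, b (z i) v = inner ℝ (y i) (ι v)
  y_succ : ∀ i, y (i + 1) = ι (Y i)
  y_eq : ∀ i, y i = y (i + 1) + k (i + 1) • x i
  x_spec : ∀ i v, b (Y i) v = inner ℝ (x i) (ι v)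

theorem exists_isResolventChain [CompleteSpace V] (ι : V →L[ℝ] H) (b : V →L[ℝ] V →L[ℝ] ℝ)
    {α : ℝ} (hα : 0 < α) (hb : ∀ u, α * ‖u‖ ^ 2 ≤ b u u) {k : ℕ → ℝ} (hk : ∀ i, 0 < k i) (h : H) :
    ∃ z y Y x, IsResolventChain ι b k h z y Y x := by
  choose R hR using fun i (h : H) => exists_resolvent ι b hα hb (hk i) h
  let z : ℕ → V := fun i => Nat.rec (R 0 h) (fun i w => R (i + 1) (ι w)) i
  -- The resolvent equation makes `A z_{i+1}` a difference quotient of elements of `V`, so `A` can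
  -- be applied once more; `x` is the corresponding quotient of `y`.
  let Y : ℕ → V := fun i => (k (i + 1))⁻¹ • (z i - z (i + 1))
  let y : ℕ → H := fun i => Nat.casesOn i ((k 0)⁻¹ • (h - ι (z 0))) (fun i => ι (Y i))
  let x : ℕ → H := fun i => (k (i + 1))⁻¹ • (y i - y (i + 1))
  have hy : ∀ i v, b (z i) v = inner ℝ (y i) (ι v) := by
    intro i v
    have hk0 := (hk i).ne'
    rcases i with _ | i
    · have := hR 0 h v
      change b (R 0 h) v = inner ℝ ((k 0)⁻¹ • (h - ι (R 0 h))) (ι v)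
      simp only [inner_smul_left, inner_sub_left, RCLike.conj_to_real]
      rw [← this]; field_simp; ring
    · have := hR (i + 1) (ι (z i)) v
      simp only [y, Y, map_smul, map_sub, inner_smul_left, inner_sub_left, RCLike.conj_to_real]
      rw [← this]
      change _ = (k (i + 1))⁻¹ * (inner ℝ (ι (z (i + 1))) (ι v) + k (i + 1) * b (z (i + 1)) v -
        inner ℝ (ι (z (i + 1))) (ι v))
      field_simp; ring
  refine ⟨z, y, Y, x, ?_, fun i => ?_, hy, fun i => rfl, fun i => ?_, fun i v => ?_⟩
  · simp [y, smul_smul, (hk 0).ne']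
  · simp [Y, smul_smul, (hk (i + 1)).ne']
  · simp [x, smul_smul, (hk (i + 1)).ne']
  · simp only [Y, x, map_smul, map_sub, inner_smul_left, inner_sub_left, RCLike.conj_to_real,
      _root_.smul_apply, _root_.sub_apply, hy, smul_eq_mul]

/-- The second elementary symmetric polynomial of `k 0, …, k i`. -/
def symmTwo (k : ℕ → ℝ) : ℕ → ℝ
  | 0 => 0
  | i + 1 => symmTwo k i + (∑ l ∈ Finset.range (i + 1), k l) * k (i + 1)

theorem symmTwo_nonneg {k : ℕ → ℝ} (hk : ∀ i, 0 < k i) (i : ℕ) : 0 ≤ symmTwo k i := by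
  induction i with
  | zero => exact le_rfl
  | succ i ih =>
    have := Finset.sum_nonneg fun l (_ : l ∈ Finset.range (i + 1)) => (hk l).le
    have := hk (i + 1)
    simp only [symmTwo]; positivity

theorem sum_range_succ_pos {k : ℕ → ℝ} (hk : ∀ i, 0 < k i) (i : ℕ) :
    0 < ∑ l ∈ Finset.range (i + 1), k l :=
  Finset.sum_pos (fun l _ => hk l) (by simp)

/-- Comparability of neighbouring steps gives `e₂ ≥ c s²`. -/
theorem sq_sum_le_symmTwo {k : ℕ → ℝ} (hk : ∀ i, 0 < k i) {κ : ℝ} (hκ : 0 < κ) {n : ℕ}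
    (h0 : 1 < n → k 0 ≤ κ * k 1) (h1 : ∀ i, i + 1 < n → k (i + 1) ≤ κ * k i) (i : ℕ)
    (hi : i + 1 < n) :
    (∑ l ∈ Finset.range (i + 2), k l) ^ 2 ≤ (2 * κ + 2) * symmTwo k (i + 1) := by
  induction i with
  | zero =>
    have a := h0 hi
    have c := h1 0 hi
    have p0 := hk 0
    have p1 := hk 1
    simp only [Finset.sum_range_succ, Finset.sum_range_zero, symmTwo, zero_add]
    simp only [zero_add] at c
    nlinarith
  | succ i ih =>
    have ih := ih (by omega)
    have c := h1 (i + 1) hi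
    have p := hk (i + 1 + 1)
    have hs : k (i + 1) ≤ ∑ l ∈ Finset.range (i + 2), k l :=
      Finset.single_le_sum (f := k) (fun l _ => (hk l).le) (by simp)
    rw [Finset.sum_range_succ, symmTwo]
    set s := ∑ l ∈ Finset.range (i + 2), k l with hsdef
    change (s + k (i + 1 + 1)) ^ 2 ≤ (2 * κ + 2) * (symmTwo k (i + 1) + s * k (i + 1 + 1))
    have : k (i + 1 + 1) ≤ κ * s := c.trans (by gcongr)
    have : 0 < s := (hk _).trans_le hs
    nlinarith [mul_pos this p]

namespace IsResolventChain

variable {ι : V →L[ℝ] H} {b : V →L[ℝ] V →L[ℝ] ℝ} {k : ℕ → ℝ} {h : H}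
  {z : ℕ → V} {y : ℕ → H} {Y : ℕ → V} {x : ℕ → H}

theorem inner_z_y (c : IsResolventChain ι b k h z y Y x) (hb : ∀ u, 0 ≤ b u u) (i : ℕ) :
    0 ≤ inner ℝ (ι (z i)) (y i) := by
  rw [real_inner_comm, ← c.y_spec]; exact hb _

theorem inner_y_x (c : IsResolventChain ι b k h z y Y x) (hb : ∀ u, 0 ≤ b u u) (i : ℕ) :
    0 ≤ inner ℝ (y (i + 1)) (x i) := by
  rw [real_inner_comm, c.y_succ, ← c.x_spec]; exact hb _

theorem inner_z_x (c : IsResolventChain ι b k h z y Y x) (hs : ∀ u v, b u v = b v u) (i : ℕ) :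
    0 ≤ inner ℝ (ι (z (i + 1))) (x i) := by
  rw [real_inner_comm, ← c.x_spec, hs, c.y_spec, ← c.y_succ]; exact real_inner_self_nonneg

theorem norm_zero (c : IsResolventChain ι b k h z y Y x) (hb : ∀ u, 0 ≤ b u u)
    (hk : ∀ i, 0 < k i) : ‖ι (z 0)‖ ≤ ‖h‖ ∧ k 0 * ‖y 0‖ ≤ ‖h‖ := by
  have h1 := c.inner_z_y hb 0
  have h2 := c.z_zero
  have h3 := (hk 0).le
  constructor
  · rw [← h2]
    apply norm_le_norm_add_of_inner_nonneg
    rw [inner_smul_right]; positivity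
  · calc k 0 * ‖y 0‖ = ‖k 0 • y 0‖ := by rw [norm_smul, Real.norm_of_nonneg h3]
      _ ≤ ‖k 0 • y 0 + ι (z 0)‖ := by
        apply norm_le_norm_add_of_inner_nonneg
        rw [inner_smul_left, real_inner_comm]; simp only [RCLike.conj_to_real]; positivity
      _ = ‖h‖ := by rw [add_comm, h2]

/-- The left side is the part of order at most two in `A` of the expansion of `∏ (1 + k_l A)
z_{i+1}`. Passing to `z_{i+2}` reproduces it with updated symmetric polynomials, plus a multiple of
`A³ z_{i+2}`, which can be dropped by positivity. -/
theorem norm_combination_le (c : IsResolventChain ι b k h z y Y x) (hb : ∀ u, 0 ≤ b u u)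
    (hs : ∀ u v, b u v = b v u) (hk : ∀ i, 0 < k i) (i : ℕ) :
    ‖ι (z (i + 1)) + (∑ l ∈ Finset.range (i + 2), k l) • y (i + 1) + symmTwo k (i + 1) • x i‖
      ≤ ‖h‖ := by
  induction i with
  | zero =>
    have h1 := c.z_zero
    rw [c.z_succ, c.y_eq, map_add, map_smul, ← c.y_succ] at h1
    apply le_of_eq
    rw [← h1]
    simp only [Finset.sum_range_succ, Finset.sum_range_zero, symmTwo, zero_add]
    congr 1
    module
  | succ i ih =>
    refine le_trans ?_ ih
    -- `X` is a lift to `V` of `A² z_{i+2}`, and `q` is `A³ z_{i+2}`.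
    set X : V := (k (i + 2))⁻¹ • (Y i - Y (i + 1)) with hX
    set q : H := (k (i + 2))⁻¹ • (x i - x (i + 1)) with hq
    have hk0 := (hk (i + 2)).ne'
    have hXx : ι X = x (i + 1) := by
      rw [hX, map_smul, map_sub, ← c.y_succ, ← c.y_succ, c.y_eq (i + 1), add_sub_cancel_left,
        smul_smul, inv_mul_cancel₀ hk0, one_smul]
    have hqX : ∀ v, b X v = inner ℝ q (ι v) := fun v => by
      simp only [hX, hq, map_smul, map_sub, inner_smul_left, inner_sub_left, RCLike.conj_to_real,
        _root_.smul_apply, _root_.sub_apply, c.x_spec, smul_eq_mul]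
    have hxq : x i = x (i + 1) + k (i + 2) • q := by
      rw [hq, smul_smul, mul_inv_cancel₀ hk0, one_smul]; abel
    have n1 : 0 ≤ inner ℝ (ι (z (i + 2))) q := by
      rw [real_inner_comm, ← hqX, hs, c.y_spec, hXx]; exact c.inner_y_x hb (i + 1)
    have n2 : 0 ≤ inner ℝ (y (i + 2)) q := by
      rw [real_inner_comm, c.y_succ, ← hqX, hs, c.x_spec, hXx]; exact real_inner_self_nonneg
    have n3 : 0 ≤ inner ℝ (x (i + 1)) q := by
      rw [real_inner_comm, ← hXx, ← hqX]; exact hb _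
    have p1 := sum_range_succ_pos hk (i + 1)
    have p2 := symmTwo_nonneg hk (i + 1)
    have p3 := symmTwo_nonneg hk (i + 2)
    have p4 := hk (i + 2)
    have p5 := sum_range_succ_pos hk (i + 2)
    have key : ι (z (i + 1)) + (∑ l ∈ Finset.range (i + 2), k l) • y (i + 1)
          + symmTwo k (i + 1) • x i
        = (ι (z (i + 2)) + (∑ l ∈ Finset.range (i + 3), k l) • y (i + 2)
          + symmTwo k (i + 2) • x (i + 1)) + (symmTwo k (i + 1) * k (i + 2)) • q := by
      rw [c.z_succ (i + 1), c.y_eq (i + 1), hxq, map_add, map_smul, ← c.y_succ,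
        Finset.sum_range_succ _ (i + 2), symmTwo.eq_2 k (i + 1)]
      module
    rw [key]
    apply norm_le_norm_add_of_inner_nonneg
    simp only [inner_add_left, inner_smul_left, inner_smul_right, RCLike.conj_to_real]
    positivity

/-- Each of the three summands in `norm_combination_le` has nonnegative inner product with the other
two, so each is bounded separately. -/
theorem norm_succ (c : IsResolventChain ι b k h z y Y x) (hb : ∀ u, 0 ≤ b u u)
    (hs : ∀ u v, b u v = b v u) (hk : ∀ i, 0 < k i) (i : ℕ) :
    ‖ι (z (i + 1))‖ ≤ ‖h‖ ∧ (∑ l ∈ Finset.range (i + 2), k l) * ‖y (i + 1)‖ ≤ ‖h‖ ∧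
      symmTwo k (i + 1) * ‖x i‖ ≤ ‖h‖ := by
  have h0 := c.norm_combination_le hb hs hk i
  have p1 := sum_range_succ_pos hk (i + 1)
  have p2 := symmTwo_nonneg hk (i + 1)
  have n1 := c.inner_z_y hb (i + 1)
  have n2 := c.inner_y_x hb i
  have n3 := c.inner_z_x hs i
  set s := ∑ l ∈ Finset.range (i + 2), k l
  set e := symmTwo k (i + 1)
  refine ⟨?_, ?_, ?_⟩
  · refine le_trans ?_ h0
    rw [add_assoc]
    apply norm_le_norm_add_of_inner_nonneg
    simp only [inner_add_right, inner_smul_right]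
    positivity
  · refine le_trans ?_ h0
    rw [show s * ‖y (i + 1)‖ = ‖s • y (i + 1)‖ by rw [norm_smul, Real.norm_of_nonneg p1.le],
      show ι (z (i + 1)) + s • y (i + 1) + e • x i = s • y (i + 1) + (ι (z (i + 1)) + e • x i) by
        abel]
    apply norm_le_norm_add_of_inner_nonneg
    rw [real_inner_comm] at n1
    simp only [inner_add_right, inner_smul_right, inner_smul_left, RCLike.conj_to_real]
    positivity
  · refine le_trans ?_ h0
    rw [show e * ‖x i‖ = ‖e • x i‖ by rw [norm_smul, Real.norm_of_nonneg p2], add_comm]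
    apply norm_le_norm_add_of_inner_nonneg
    rw [real_inner_comm] at n2 n3
    simp only [inner_add_right, inner_smul_right, inner_smul_left, RCLike.conj_to_real]
    positivity

theorem norm_z_le (c : IsResolventChain ι b k h z y Y x) (hb : ∀ u, 0 ≤ b u u)
    (hs : ∀ u v, b u v = b v u) (hk : ∀ i, 0 < k i) (i : ℕ) : ‖ι (z i)‖ ≤ ‖h‖ := by
  rcases i with _ | i
  · exact (c.norm_zero hb hk).1
  · exact (c.norm_succ hb hs hk i).1

theorem norm_y_le (c : IsResolventChain ι b k h z y Y x) (hb : ∀ u, 0 ≤ b u u)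
    (hs : ∀ u v, b u v = b v u) (hk : ∀ i, 0 < k i) (i : ℕ) :
    ‖y i‖ ≤ ‖h‖ / ∑ l ∈ Finset.range (i + 1), k l := by
  rw [le_div_iff₀ (sum_range_succ_pos hk i), mul_comm]
  rcases i with _ | i
  · simpa using (c.norm_zero hb hk).2
  · exact (c.norm_succ hb hs hk i).2.1

/-- The smoothing estimate `‖A R h‖_V ≤ C s^{-3/2} ‖h‖`. -/
theorem norm_Y_le (c : IsResolventChain ι b k h z y Y x) {α : ℝ} (hα : 0 < α)
    (hb : ∀ u, α * ‖u‖ ^ 2 ≤ b u u)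
    (hs : ∀ u v, b u v = b v u) (hk : ∀ i, 0 < k i) {κ : ℝ} (hκ : 0 < κ) {n : ℕ}
    (h0 : 1 < n → k 0 ≤ κ * k 1) (h1 : ∀ i, i + 1 < n → k (i + 1) ≤ κ * k i) (i : ℕ)
    (hi : i + 1 < n) :
    ‖Y i‖ ≤ √((2 * κ + 2) / α) * ‖h‖ / (∑ l ∈ Finset.range (i + 2), k l) ^ (3 / 2 : ℝ) := by
  have hb0 : ∀ u, 0 ≤ b u u := fun u => le_trans (by positivity) (hb u)
  have p1 := sum_range_succ_pos hk (i + 1)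
  obtain ⟨-, a2, a3⟩ := c.norm_succ hb0 hs hk i
  have a4 := sq_sum_le_symmTwo hk hκ h0 h1 i hi
  -- Interpolation: coercivity bounds the form norm of `A z` by the geometric mean of `‖A² z‖` and
  -- `‖A z‖`, of orders `s⁻²` and `s⁻¹`.
  have a5 : α * ‖Y i‖ ^ 2 ≤ ‖x i‖ * ‖y (i + 1)‖ := by
    refine (hb _).trans ?_
    rw [c.x_spec, ← c.y_succ]; exact real_inner_le_norm _ _
  set s := ∑ l ∈ Finset.range (i + 2), k l
  set e := symmTwo k (i + 1)
  have hp : 0 < s ^ (3 / 2 : ℝ) := by positivity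
  have hs3 : (s ^ (3 / 2 : ℝ)) ^ 2 = s ^ 3 := by
    rw [← Real.rpow_natCast, ← Real.rpow_mul p1.le, ← Real.rpow_natCast]; norm_num
  rw [le_div_iff₀ hp]
  refine abs_le_of_sq_le_sq' ?_ (by positivity) |>.2
  rw [mul_pow, mul_pow, hs3, Real.sq_sqrt (by positivity), div_mul_eq_mul_div, le_div_iff₀ hα]
  have t1 : s ^ 2 * ‖x i‖ ≤ (2 * κ + 2) * ‖h‖ := by
    calc s ^ 2 * ‖x i‖ ≤ ((2 * κ + 2) * e) * ‖x i‖ := by gcongr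
      _ = (2 * κ + 2) * (e * ‖x i‖) := by ring
      _ ≤ _ := by gcongr
  calc ‖Y i‖ ^ 2 * s ^ 3 * α = (α * ‖Y i‖ ^ 2) * s ^ 3 := by ring
    _ ≤ (‖x i‖ * ‖y (i + 1)‖) * s ^ 3 := by gcongr
    _ = (s ^ 2 * ‖x i‖) * (s * ‖y (i + 1)‖) := by ring
    _ ≤ ((2 * κ + 2) * ‖h‖) * ‖h‖ := by gcongr
    _ = _ := by ring

end IsResolventChain

end Abstract

/-! ### Duhamel formula with frozen operator, and the two sums it produces. -/

section Abstract

variable {V H : Type*} [NormedAddCommGroup V] [InnerProductSpace ℝ V]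
  [NormedAddCommGroup H] [InnerProductSpace ℝ H]

/-- Discrete Duhamel formula with the operator frozen at index `0`; time runs backwards in the
index, so that `U 0` is the final and `U (N + 1)` the initial value. -/
theorem IsResolventChain.duhamel {ι : V →L[ℝ] H} {b : ℕ → V →L[ℝ] V →L[ℝ] ℝ} {k : ℕ → ℝ} {h : H}
    {z : ℕ → V} {y : ℕ → H} {Y : ℕ → V} {x : ℕ → H} (c : IsResolventChain ι (b 0) k h z y Y x)
    (hs : ∀ u v, b 0 u v = b 0 v u) {U : ℕ → V} {v f : ℕ → H} (N : ℕ)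
    (hv : ∀ i ≤ N, ∀ w, b i (U i) w = inner ℝ (v i) (ι w))
    (hstep : ∀ i ≤ N, k i • v i = k i • f i - (ι (U i) - ι (U (i + 1)))) :
    inner ℝ (v 0) h = inner ℝ (y N) (ι (U (N + 1)))
      + ∑ i ∈ Finset.range (N + 1), k i * inner ℝ (f i) (y i)
      + ∑ i ∈ Finset.range N,
          k (i + 1) * (b 0 (U (i + 1)) (Y i) - b (i + 1) (U (i + 1)) (Y i)) := by
  have hst : ∀ i ≤ N, k i * inner ℝ (v i) (y i) = k i * inner ℝ (f i) (y i)
      - (inner ℝ (ι (U i)) (y i) - inner ℝ (ι (U (i + 1))) (y i)) := fun i hi => by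
    have := congrArg (fun w => inner ℝ w (y i)) (hstep i hi)
    simpa only [inner_smul_left, inner_sub_left, RCLike.conj_to_real] using this
  induction N with
  | zero =>
    have h1 := hst 0 le_rfl
    have h2 : inner ℝ (v 0) (ι (z 0)) = inner ℝ (ι (U 0)) (y 0) := by
      rw [← hv 0 le_rfl, hs, c.y_spec, real_inner_comm]
    rw [← c.z_zero, inner_add_right, inner_smul_right, h1, h2, zero_add, Finset.sum_range_one,
      Finset.sum_range_zero, real_inner_comm (ι (U 1)) (y 0)]
    ring
  | succ N ih =>
    rw [ih (fun i hi => hv i (by omega)) (fun i hi => hstep i (by omega))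
      (fun i hi => hst i (by omega)), Finset.sum_range_succ _ (N + 1), Finset.sum_range_succ
        (fun i => k (i + 1) * (b 0 (U (i + 1)) (Y i) - b (i + 1) (U (i + 1)) (Y i))) N]
    have h1 := hst (N + 1) le_rfl
    have h2 : b (N + 1) (U (N + 1)) (Y N) = inner ℝ (v (N + 1)) (y (N + 1)) := by
      rw [hv _ le_rfl, c.y_succ]
    have h3 : inner ℝ (y N) (ι (U (N + 1))) = inner ℝ (y (N + 1)) (ι (U (N + 1)))
        + k (N + 1) * b 0 (U (N + 1)) (Y N) := by
      rw [hs, c.x_spec, c.y_eq N, inner_add_left, inner_smul_left, RCLike.conj_to_real]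
    rw [h3, mul_sub, h2, h1, real_inner_comm (ι (U (N + 1))) (y (N + 1)),
      real_inner_comm (ι (U (N + 1 + 1))) (y (N + 1))]
    ring

/-- The Duhamel formula is applied with `h = v 0`; every term carries a factor `‖v 0‖`, which is
cancelled at the end. -/
theorem norm_le_of_duhamel [CompleteSpace V] (ι : V →L[ℝ] H) (b : ℕ → V →L[ℝ] V →L[ℝ] ℝ)
    {k : ℕ → ℝ} (hk : ∀ i, 0 < k i) {α : ℝ} (hα : 0 < α) (hb : ∀ u, α * ‖u‖ ^ 2 ≤ b 0 u u)
    (hs : ∀ u v, b 0 u v = b 0 v u) {U : ℕ → V} {v f : ℕ → H} (N : ℕ) {κ : ℝ} (hκ : 0 < κ)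
    (h0 : 1 < N + 1 → k 0 ≤ κ * k 1) (h1 : ∀ i, i + 1 < N + 1 → k (i + 1) ≤ κ * k i)
    (hv : ∀ i ≤ N, ∀ w, b i (U i) w = inner ℝ (v i) (ι w))
    (hstep : ∀ i ≤ N, k i • v i = k i • f i - (ι (U i) - ι (U (i + 1))))
    {g : H} (hg : ∀ w, b 0 (U (N + 1)) w = inner ℝ g (ι w)) {F : ℝ} (hF : ∀ i ≤ N, ‖f i‖ ≤ F)
    {W : ℕ → ℝ} (hW : ∀ i < N, ∀ u w, |b 0 u w - b (i + 1) u w| ≤ W i * ‖u‖ * ‖w‖) :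
    ‖v 0‖ ≤ ‖g‖ + F * ∑ i ∈ Finset.range (N + 1), k i / ∑ l ∈ Finset.range (i + 1), k l
      + √((2 * κ + 2) / α) * ∑ i ∈ Finset.range N,
          k (i + 1) * (W i / (∑ l ∈ Finset.range (i + 2), k l) ^ (3 / 2 : ℝ)) * ‖U (i + 1)‖ := by
  obtain ⟨z, y, Y, x, c⟩ := exists_isResolventChain ι (b 0) hα hb hk (v 0)
  have hb0 : ∀ u, 0 ≤ b 0 u u := fun u => le_trans (by positivity) (hb u)
  have hd := c.duhamel hs N hv hstep
  rw [real_inner_self_eq_norm_sq] at hd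
  -- By symmetry the frozen operator moves from `z N` to the initial value, so only the contraction
  -- bound on `z N` is needed.
  have t1 : inner ℝ (y N) (ι (U (N + 1))) ≤ ‖g‖ * ‖v 0‖ := by
    rw [← c.y_spec, hs, hg]
    exact (real_inner_le_norm _ _).trans
      (mul_le_mul_of_nonneg_left (c.norm_z_le hb0 hs hk N) (norm_nonneg _))
  have t2 : ∑ i ∈ Finset.range (N + 1), k i * inner ℝ (f i) (y i) ≤
      (F * ∑ i ∈ Finset.range (N + 1), k i / ∑ l ∈ Finset.range (i + 1), k l) * ‖v 0‖ := by
    rw [Finset.mul_sum, Finset.sum_mul]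
    refine Finset.sum_le_sum fun i hi => ?_
    have hi' : i ≤ N := by simpa [Nat.lt_succ_iff] using hi
    have a1 := c.norm_y_le hb0 hs hk i
    have a2 := hF i hi'
    have a3 : 0 ≤ F := (norm_nonneg _).trans a2
    have a4 := hk i
    calc k i * inner ℝ (f i) (y i) ≤ k i * (‖f i‖ * ‖y i‖) := by
          gcongr; exact real_inner_le_norm _ _
      _ ≤ k i * (F * (‖v 0‖ / ∑ l ∈ Finset.range (i + 1), k l)) := by gcongr
      _ = _ := by ring
  have t3 : ∑ i ∈ Finset.range N, k (i + 1) * (b 0 (U (i + 1)) (Y i) - b (i + 1) (U (i + 1)) (Y i))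
      ≤ (√((2 * κ + 2) / α) * ∑ i ∈ Finset.range N,
          k (i + 1) * (W i / (∑ l ∈ Finset.range (i + 2), k l) ^ (3 / 2 : ℝ)) * ‖U (i + 1)‖)
        * ‖v 0‖ := by
    rw [Finset.mul_sum, Finset.sum_mul]
    refine Finset.sum_le_sum fun i hi => ?_
    have hi' : i < N := by simpa using hi
    have a1 := c.norm_Y_le hα hb hs hk hκ h0 h1 i (by omega)
    have a2 := (le_abs_self _).trans (hW i hi' (U (i + 1)) (Y i))
    have a4 := hk (i + 1)
    -- The sign of `W i` is not assumed; it follows from `hW` only when `U (i + 1)` is nonzero.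
    by_cases hU : ‖U (i + 1)‖ = 0
    · rw [hU] at a2 ⊢
      have : k (i + 1) * (b 0 (U (i + 1)) (Y i) - b (i + 1) (U (i + 1)) (Y i)) ≤ k (i + 1) * 0 := by
        gcongr; simpa using a2
      simpa using this
    have hW0 : 0 ≤ W i := by
      have := (abs_nonneg _).trans (hW i hi' (U (i + 1)) (U (i + 1)))
      have hp : 0 < ‖U (i + 1)‖ := lt_of_le_of_ne (norm_nonneg _) (Ne.symm hU)
      by_contra hneg
      push Not at hneg
      nlinarith [mul_pos hp hp]
    calc k (i + 1) * (b 0 (U (i + 1)) (Y i) - b (i + 1) (U (i + 1)) (Y i))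
        ≤ k (i + 1) * (W i * ‖U (i + 1)‖ * ‖Y i‖) := by gcongr
      _ ≤ k (i + 1) * (W i * ‖U (i + 1)‖ * (√((2 * κ + 2) / α) * ‖v 0‖ /
          (∑ l ∈ Finset.range (i + 2), k l) ^ (3 / 2 : ℝ))) := by gcongr
      _ = _ := by ring
  have hnn : 0 ≤ ∑ i ∈ Finset.range N,
      k (i + 1) * (W i / (∑ l ∈ Finset.range (i + 2), k l) ^ (3 / 2 : ℝ)) * ‖U (i + 1)‖ := by
    refine Finset.sum_nonneg fun i hi => ?_
    have hi' : i < N := by simpa using hi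
    have a4 := hk (i + 1)
    have a5 := sum_range_succ_pos hk (i + 1)
    have a6 : 0 ≤ W i * ‖U (i + 1)‖ := by
      by_cases hU : ‖U (i + 1)‖ = 0
      · simp [hU]
      have hp : 0 < ‖U (i + 1)‖ := lt_of_le_of_ne (norm_nonneg _) (Ne.symm hU)
      have := (abs_nonneg _).trans (hW i hi' (U (i + 1)) (U (i + 1)))
      exact nonneg_of_mul_nonneg_left this hp
    have : k (i + 1) * (W i / (∑ l ∈ Finset.range (i + 2), k l) ^ (3 / 2 : ℝ)) * ‖U (i + 1)‖
      = k (i + 1) * (W i * ‖U (i + 1)‖) / (∑ l ∈ Finset.range (i + 2), k l) ^ (3 / 2 : ℝ) := by ring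
    rw [this]; positivity
  by_cases hv0 : ‖v 0‖ = 0
  · rw [hv0]
    have hF0 : 0 ≤ F := (norm_nonneg _).trans (hF 0 (by omega))
    have : 0 ≤ ∑ i ∈ Finset.range (N + 1), k i / ∑ l ∈ Finset.range (i + 1), k l :=
      Finset.sum_nonneg fun i _ => div_nonneg (hk i).le (sum_range_succ_pos hk i).le
    positivity
  · have hp : 0 < ‖v 0‖ := lt_of_le_of_ne (norm_nonneg _) (Ne.symm hv0)
    refine le_of_mul_le_mul_right ?_ hp
    nlinarith

/-- With partial sums `s_i`, the term with `i = 0` is 1, and each later one is `1 - s_{i-1} / s_i ≤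
log (s_i / s_{i-1})`, which telescopes. -/
theorem sum_div_sum_le_log {k : ℕ → ℝ} (hk : ∀ i, 0 < k i) (N : ℕ) :
    ∑ i ∈ Finset.range (N + 1), k i / ∑ l ∈ Finset.range (i + 1), k l ≤
      1 + Real.log ((∑ l ∈ Finset.range (N + 1), k l) / k 0) := by
  induction N with
  | zero => simp [(hk 0).ne']
  | succ N ih =>
    rw [Finset.sum_range_succ]
    have p1 := sum_range_succ_pos hk N
    have p2 := sum_range_succ_pos hk (N + 1)
    have p0 := hk 0
    have e : ∑ l ∈ Finset.range (N + 1 + 1), k l = ∑ l ∈ Finset.range (N + 1), k l + k (N + 1) :=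
      Finset.sum_range_succ _ _
    have h1 := Real.one_sub_inv_le_log_of_pos
      (div_pos p2 p1)
    rw [Real.log_div p2.ne' p1.ne'] at h1
    rw [Real.log_div p1.ne' p0.ne'] at ih
    rw [Real.log_div p2.ne' p0.ne']
    have h2 : k (N + 1) / ∑ l ∈ Finset.range (N + 1 + 1), k l
        = 1 - ((∑ l ∈ Finset.range (N + 1 + 1), k l) / ∑ l ∈ Finset.range (N + 1), k l)⁻¹ := by
      rw [inv_div]; field_simp; rw [e]; ring
    linarith

/-- A right-endpoint Riemann sum of a decreasing function lies below its integral. The first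
interval, where `φ` may be singular, carries no term: the frozen operator is exact there. -/
theorem sum_mul_le_integral {k : ℕ → ℝ} (hk : ∀ i, 0 < k i) {T : ℝ} {φ : ℝ → ℝ}
    (h0 : ∀ s ∈ Ioc 0 T, 0 ≤ φ s) (hanti : AntitoneOn φ (Ioc 0 T)) (hint : IntegrableOn φ (Ioc 0 T))
    (N : ℕ) (hN : ∑ l ∈ Finset.range (N + 1), k l ≤ T) :
    ∑ i ∈ Finset.range N, k (i + 1) * φ (∑ l ∈ Finset.range (i + 2), k l) ≤
      ∫ s in Ioc 0 T, φ s := by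
  have key : ∀ n ≤ N, ∑ i ∈ Finset.range n, k (i + 1) * φ (∑ l ∈ Finset.range (i + 2), k l) ≤
      ∫ s in Ioc 0 (∑ l ∈ Finset.range (n + 1), k l), φ s := by
    intro n
    induction n with
    | zero =>
      intro _
      simp only [Finset.range_zero, Finset.sum_empty]
      refine setIntegral_nonneg measurableSet_Ioc fun s hs => h0 s ⟨hs.1, hs.2.trans ?_⟩
      refine le_trans ?_ hN
      exact Finset.sum_le_sum_of_subset_of_nonneg (by simp) fun i _ _ => (hk i).le
    | succ n ih =>
      intro hn
      have ih := ih (by omega)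
      rw [Finset.sum_range_succ]
      have e : ∑ l ∈ Finset.range (n + 1 + 1), k l = ∑ l ∈ Finset.range (n + 1), k l + k (n + 1) :=
        Finset.sum_range_succ _ _
      have p1 := sum_range_succ_pos hk n
      have p2 := hk (n + 1)
      have hT : ∑ l ∈ Finset.range (n + 1 + 1), k l ≤ T := by
        refine le_trans ?_ hN
        exact Finset.sum_le_sum_of_subset_of_nonneg
          (Finset.range_subset_range.2 (by omega)) fun i _ _ => (hk i).le
      set s := ∑ l ∈ Finset.range (n + 1), k l
      set s' := ∑ l ∈ Finset.range (n + 1 + 1), k l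
      have hss : s ≤ s' := by linarith
      rw [← Ioc_union_Ioc_eq_Ioc p1.le hss,
        setIntegral_union (Ioc_disjoint_Ioc_of_le le_rfl) measurableSet_Ioc
          (hint.mono_set (Ioc_subset_Ioc_right (hss.trans hT)))
          (hint.mono_set (Ioc_subset_Ioc p1.le hT))]
      have : k (n + 1) * φ s' ≤ ∫ t in Ioc s s', φ t := by
        have h1 : ∫ t in Ioc s s', φ s' ≤ ∫ t in Ioc s s', φ t := by
          refine setIntegral_mono_on (by simp) (hint.mono_set (Ioc_subset_Ioc p1.le hT))
            measurableSet_Ioc fun t ht => ?_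
          exact hanti ⟨p1.trans ht.1, ht.2.trans hT⟩ ⟨p1.trans_le hss, hT⟩ ht.2
        rw [setIntegral_const, Real.volume_real_Ioc_of_le hss, smul_eq_mul, e,
          add_sub_cancel_left] at h1
        rwa [e]
      exact add_le_add ih this
  refine (key N le_rfl).trans ?_
  refine setIntegral_mono_set hint ?_ (Ioc_subset_Ioc_right hN).eventuallyLE
  exact (ae_restrict_iff' measurableSet_Ioc).2 (Filter.Eventually.of_forall h0)

end Abstract

/-! ### The space `H¹₀(Ω)` and Poincaré's inequality. -/

section Sobolev

/-- Bounded linear maps, with the structure induced by the inner products. -/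
abbrev BoundedMap (V H : Type*) [NormedAddCommGroup V] [InnerProductSpace ℝ V]
    [NormedAddCommGroup H] [InnerProductSpace ℝ H] : Type _ := V →L[ℝ] H

/-- Bounded bilinear forms, with the structure induced by the inner product. -/
abbrev BoundedForm (V : Type*) [NormedAddCommGroup V] [InnerProductSpace ℝ V] : Type _ :=
  V →L[ℝ] V →L[ℝ] ℝ

variable {d : ℕ} {Ω : Set (E d)}

instance : CompleteSpace (H10 Ω) :=
  (Submodule.isClosed_topologicalClosure _).completeSpace_coe

/-- The inclusion `H¹₀(Ω) ↪ L²(Ω)` as a continuous linear map. -/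
def valL (Ω : Set (E d)) : BoundedMap (H10 Ω) (L2 Ω) :=
  (WithLp.fstL 2 ℝ (L2 Ω) (PiLp 2 fun _ : Fin d => L2 Ω)).comp (H10 Ω).subtypeL

theorem valL_apply (u : H10 Ω) : valL Ω u = val u := rfl

theorem pd_add (i : Fin d) (u v : H10 Ω) : pd i (u + v) = pd i u + pd i v := rfl

theorem pd_smul (i : Fin d) (r : ℝ) (u : H10 Ω) : pd i (r • u) = r • pd i u := rfl

theorem norm_sq_eq (u : H10 Ω) : ‖u‖ ^ 2 = ‖val u‖ ^ 2 + ∑ i, ‖pd i u‖ ^ 2 := by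
  rw [Submodule.coe_norm, WithLp.prod_norm_sq_eq_of_L2, PiLp.norm_sq_eq_of_L2]; rfl

theorem norm_val_le (u : H10 Ω) : ‖val u‖ ≤ ‖u‖ := by
  refine abs_le_of_sq_le_sq' ?_ (norm_nonneg _) |>.2
  rw [norm_sq_eq]
  have := Finset.sum_nonneg fun i (_ : i ∈ Finset.univ) => sq_nonneg ‖pd i u‖
  linarith

theorem norm_pd_le (i : Fin d) (u : H10 Ω) : ‖pd i u‖ ≤ ‖u‖ := by
  refine abs_le_of_sq_le_sq' ?_ (norm_nonneg _) |>.2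
  rw [norm_sq_eq]
  have := Finset.single_le_sum (f := fun i => ‖pd i u‖ ^ 2) (fun i _ => sq_nonneg _)
    (Finset.mem_univ i)
  have := sq_nonneg ‖val u‖
  linarith

theorem L2.norm_sq_eq_integral (f : L2 Ω) : ‖f‖ ^ 2 = ∫ x in Ω, (f x) ^ 2 := by
  rw [← real_inner_self_eq_norm_sq, MeasureTheory.L2.inner_def]
  refine integral_congr_ae (Filter.Eventually.of_forall fun x => ?_)
  simp

/-- Poincaré's inequality for smooth functions with compact support in a set of bounded width. -/
theorem integral_sq_le_of_tsupport_subset {φ : E d → ℝ} (hφ : ContDiff ℝ (⊤ : ℕ∞) φ)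
    (hc : HasCompactSupport φ) {R : ℝ} (i : Fin d) (hR : ∀ x ∈ tsupport φ, |x i| ≤ R) :
    ∫ x, φ x ^ 2 ≤ 4 * R ^ 2 * ∫ x, fderiv ℝ φ x (EuclideanSpace.single i 1) ^ 2 := by
  set e : E d := EuclideanSpace.single i 1
  have hd : Differentiable ℝ φ := hφ.differentiable (by simp)
  have hcφ : Continuous φ := hφ.continuous
  have hcd : Continuous fun x => fderiv ℝ φ x e :=
    (hφ.continuous_fderiv (by simp)).clm_apply continuous_const
  have hx : Continuous fun x : E d => x i := by fun_prop
  have hcs : HasCompactSupport fun x => φ x ^ 2 := by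
    simp only [pow_two]; exact hc.mul_left (f := φ)
  have hcs' : HasCompactSupport fun x => fderiv ℝ φ x e := hc.fderiv_apply ℝ e
  have hcs'' : HasCompactSupport fun x => fderiv ℝ φ x e ^ 2 := by
    simp only [pow_two]; exact hcs'.mul_left (f := fun x => fderiv ℝ φ x e)
  have i1 : Integrable fun x => φ x ^ 2 := (hcφ.pow 2).integrable_of_hasCompactSupport hcs
  have i2 : Integrable fun x => fderiv ℝ φ x e ^ 2 :=
    (hcd.pow 2).integrable_of_hasCompactSupport hcs''
  have i3 : Integrable fun x => x i * (2 * φ x * fderiv ℝ φ x e) :=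
    (hx.mul ((continuous_const.mul hcφ).mul hcd)).integrable_of_hasCompactSupport
      ((hcs'.mul_left (f := fun x => 2 * φ x)).mul_left (f := fun x : E d => x i))
  have f1 : ∀ x, fderiv ℝ (fun x : E d => x i) x e = 1 := fun x => by
    have : HasFDerivAt (fun x : E d => x i) (EuclideanSpace.proj (𝕜 := ℝ) i) x :=
      (EuclideanSpace.proj i : E d →L[ℝ] ℝ).hasFDerivAt
    rw [this.fderiv]; simp [e]
  have f2 : ∀ x, fderiv ℝ (fun x => φ x ^ 2) x e = 2 * φ x * fderiv ℝ φ x e := fun x => by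
    rw [((hd x).hasFDerivAt.pow 2).fderiv]; simp
  have hibp := integral_mul_fderiv_eq_neg_fderiv_mul_of_integrable (μ := (volume : Measure (E d)))
    (f := fun x : E d => x i) (g := fun x => φ x ^ 2) (v := e)
    (by simpa only [f1, one_mul] using i1) (by simpa only [f2] using i3)
    ((hx.mul (hcφ.pow 2)).integrable_of_hasCompactSupport
      (hcs.mul_left (f := fun x : E d => x i)))
    (fun x _ => (EuclideanSpace.proj i : E d →L[ℝ] ℝ).differentiableAt)
    (fun x _ => (hd x).pow 2)
  simp only [f1, f2, one_mul] at hibp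
  -- Integration by parts against `x i` turns `∫ φ²` into this integral; Young's inequality leaves
  -- half of `∫ φ²` to be absorbed on the left.
  have hle : -∫ x, x i * (2 * φ x * fderiv ℝ φ x e) ≤
      ∫ x, (1 / 2 * φ x ^ 2 + 2 * R ^ 2 * fderiv ℝ φ x e ^ 2) := by
    rw [← integral_neg]
    refine integral_mono i3.neg ((i1.const_mul _).add (i2.const_mul _)) fun x => ?_
    simp only
    by_cases hxs : x ∈ tsupport φ
    · have h1 := hR x hxs
      have h2 : x i ^ 2 ≤ R ^ 2 := sq_le_sq' (abs_le.1 h1).1 (abs_le.1 h1).2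
      have h3 : x i ^ 2 * fderiv ℝ φ x e ^ 2 ≤ R ^ 2 * fderiv ℝ φ x e ^ 2 := by gcongr
      nlinarith [sq_nonneg (φ x + 2 * (x i * fderiv ℝ φ x e))]
    · rw [image_eq_zero_of_notMem_tsupport hxs]
      simp only [mul_zero, zero_mul, neg_zero]
      positivity
  rw [integral_add (i1.const_mul _) (i2.const_mul _), integral_const_mul, integral_const_mul,
    hibp, neg_neg] at hle
  linarith

theorem testPairs_add {p q : Pair Ω} (hp : p ∈ testPairs Ω) (hq : q ∈ testPairs Ω) :
    p + q ∈ testPairs Ω := by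
  obtain ⟨φ, h1, h2, h3, h4, h5⟩ := hp
  obtain ⟨ψ, k1, k2, k3, k4, k5⟩ := hq
  refine ⟨φ + ψ, h1.add k1, h2.add k2, ?_, ?_, fun i => ?_⟩
  · exact (tsupport_add φ ψ).trans (union_subset h3 k3)
  · filter_upwards [Lp.coeFn_add p.fst q.fst, h4, k4] with x e1 e2 e3
    change (p.fst + q.fst : L2 Ω) x = _
    rw [e1, Pi.add_apply, e2, e3, Pi.add_apply]
  · filter_upwards [Lp.coeFn_add (p.snd i) (q.snd i), h5 i, k5 i] with x e1 e2 e3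
    change (p.snd i + q.snd i : L2 Ω) x = _
    rw [e1, Pi.add_apply, e2, e3, fderiv_add (h1.differentiable (by simp) x)
      (k1.differentiable (by simp) x)]
    rfl

theorem testPairs_smul (r : ℝ) {p : Pair Ω} (hp : p ∈ testPairs Ω) : r • p ∈ testPairs Ω := by
  obtain ⟨φ, h1, h2, h3, h4, h5⟩ := hp
  refine ⟨r • φ, h1.const_smul r, h2.smul_left (f := fun _ => r), ?_, ?_, fun i => ?_⟩
  · exact (closure_mono (Function.support_const_smul_subset r φ)).trans h3
  · filter_upwards [Lp.coeFn_smul r p.fst, h4] with x e1 e2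
    change (r • p.fst : L2 Ω) x = _
    rw [e1, Pi.smul_apply, e2, Pi.smul_apply]
  · filter_upwards [Lp.coeFn_smul r (p.snd i), h5 i] with x e1 e2
    change (r • p.snd i : L2 Ω) x = _
    rw [e1, Pi.smul_apply, e2, fderiv_const_smul (h1.differentiable (by simp) x)]
    rfl

theorem testPairs_zero : (0 : Pair Ω) ∈ testPairs Ω := by
  refine ⟨0, contDiff_const, HasCompactSupport.zero, by simp, Lp.coeFn_zero _ _ _, fun i => ?_⟩
  refine (Lp.coeFn_zero _ _ _).trans (Filter.Eventually.of_forall fun x => ?_)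
  simp

/-- The test pairs already form a subspace, so a closed condition on `H10` need only be checked on
smooth functions. -/
theorem span_testPairs_subset : (Submodule.span ℝ (testPairs Ω) : Set (Pair Ω)) ⊆ testPairs Ω :=
  fun _ hp => Submodule.span_induction (p := fun q _ => q ∈ testPairs Ω) (fun _ h => h)
    testPairs_zero (fun _ _ _ _ => testPairs_add) (fun r _ _ => testPairs_smul r) hp

/-- Poincaré's inequality in `H¹₀(Ω)` for bounded `Ω`. -/
theorem exists_poincare (hΩb : Bornology.IsBounded Ω) (i : Fin d) :
    ∃ P : ℝ, 0 ≤ P ∧ ∀ u : H10 Ω, ‖val u‖ ^ 2 ≤ P * ‖pd i u‖ ^ 2 := by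
  obtain ⟨R, hR⟩ := hΩb.exists_norm_le
  refine ⟨4 * R ^ 2, by positivity, fun u => ?_⟩
  have hcl : IsClosed {p : Pair Ω | ‖p.fst‖ ^ 2 ≤ 4 * R ^ 2 * ‖p.snd i‖ ^ 2} := by
    refine isClosed_le ?_ ?_
    · exact ((WithLp.fstL 2 ℝ (L2 Ω) (PiLp 2 fun _ : Fin d => L2 Ω)).continuous.norm).pow 2
    · refine continuous_const.mul (Continuous.pow (Continuous.norm ?_) 2)
      exact (PiLp.proj (𝕜 := ℝ) 2 (fun _ : Fin d => L2 Ω) i).continuous.comp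
        (WithLp.sndL 2 ℝ (L2 Ω) (PiLp 2 fun _ : Fin d => L2 Ω)).continuous
  refine closure_minimal (s := (Submodule.span ℝ (testPairs Ω) : Set (Pair Ω))) ?_ hcl u.2
  intro p hp
  obtain ⟨φ, h1, h2, h3, h4, h5⟩ := span_testPairs_subset hp
  have e1 : ‖p.fst‖ ^ 2 = ∫ x, φ x ^ 2 := by
    rw [L2.norm_sq_eq_integral, ← setIntegral_eq_integral_of_forall_compl_eq_zero (s := Ω)
      (f := fun x => φ x ^ 2)]
    · exact integral_congr_ae (h4.mono fun x hx => by simp only [hx])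
    · intro x hx
      simp [image_eq_zero_of_notMem_tsupport fun h => hx (h3 h)]
  have e2 : ‖p.snd i‖ ^ 2 = ∫ x, fderiv ℝ φ x (EuclideanSpace.single i 1) ^ 2 := by
    rw [L2.norm_sq_eq_integral, ← setIntegral_eq_integral_of_forall_compl_eq_zero (s := Ω)
      (f := fun x => fderiv ℝ φ x (EuclideanSpace.single i 1) ^ 2)]
    · exact integral_congr_ae ((h5 i).mono fun x hx => by simp only [hx])
    · intro x hx
      have : fderiv ℝ φ x = 0 := by
        by_contra h
        exact hx (h3 (support_fderiv_subset ℝ h))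
      simp [this]
  change ‖p.fst‖ ^ 2 ≤ 4 * R ^ 2 * ‖p.snd i‖ ^ 2
  rw [e1, e2]
  refine integral_sq_le_of_tsupport_subset h1 h2 i fun x hx => ?_
  exact (PiLp.norm_apply_le x i).trans (hR x (h3 hx))

end Sobolev

/-! ### Bilinear forms with bounded coefficients. -/

section Forms

variable {d : ℕ} {Ω : Set (E d)}

theorem integrable_mul_mul {c : E d → ℝ} (hc : AEStronglyMeasurable c (volume.restrict Ω))
    {W : ℝ} (hW : ∀ᵐ x ∂volume.restrict Ω, |c x| ≤ W) (f g : L2 Ω) :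
    Integrable (fun x => c x * f x * g x) (volume.restrict Ω) ∧
      |∫ x in Ω, c x * f x * g x| ≤ W * ‖f‖ * ‖g‖ := by
  have hb : ∀ᵐ x ∂volume.restrict Ω, ‖c x * f x‖ ≤ W * ‖f x‖ := by
    filter_upwards [hW] with x hx
    rw [norm_mul]; gcongr; exact hx
  have hm : MemLp (fun x => c x * f x) 2 (volume.restrict Ω) :=
    (Lp.memLp f).of_le_mul (hc.mul (Lp.aestronglyMeasurable f)) hb
  have hae : ∀ᵐ x ∂volume.restrict Ω,
      inner ℝ (hm.toLp _ x) (g x) = c x * f x * g x := by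
    filter_upwards [hm.coeFn_toLp] with x hx
    rw [hx]; simp [mul_comm]
  refine ⟨(MeasureTheory.L2.integrable_inner (𝕜 := ℝ) (hm.toLp _) g).congr hae, ?_⟩
  rw [← integral_congr_ae hae, ← MeasureTheory.L2.inner_def]
  refine (abs_real_inner_le_norm _ _).trans ?_
  gcongr
  refine Lp.norm_le_mul_norm_of_ae_le_mul ?_
  filter_upwards [hm.coeFn_toLp, hb] with x hx hx'
  rwa [hx]

/-- The bilinear form `∫_Ω ∑_{i,j} c_{ij} ∂_i u ∂_j v` with time-independent coefficients. -/
def coeffForm (c : Fin d → Fin d → E d → ℝ) (u v : H10 Ω) : ℝ :=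
  ∫ x in Ω, ∑ i, ∑ j, c i j x * pd i u x * pd j v x

section Bounded

variable {c : Fin d → Fin d → E d → ℝ} {W : ℝ}

theorem integrable_coeffForm
    (hc : ∀ i j, AEStronglyMeasurable (c i j) (volume.restrict Ω))
    (hW : ∀ i j, ∀ᵐ x ∂volume.restrict Ω, |c i j x| ≤ W)
    (u v : H10 Ω) :
    Integrable (fun x => ∑ i, ∑ j, c i j x * pd i u x * pd j v x) (volume.restrict Ω) :=
  integrable_finsetSum _ fun i _ => integrable_finsetSum _ fun j _ =>
    (integrable_mul_mul (hc i j) (hW i j) _ _).1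

theorem coeffForm_eq_sum
    (hc : ∀ i j, AEStronglyMeasurable (c i j) (volume.restrict Ω))
    (hW : ∀ i j, ∀ᵐ x ∂volume.restrict Ω, |c i j x| ≤ W)
    (u v : H10 Ω) :
    coeffForm c u v = ∑ i, ∑ j, ∫ x in Ω, c i j x * pd i u x * pd j v x := by
  rw [coeffForm, integral_finsetSum _ fun i _ => integrable_finsetSum _ fun j _ =>
    (integrable_mul_mul (hc i j) (hW i j) _ _).1]
  refine Finset.sum_congr rfl fun i _ => integral_finsetSum _ fun j _ =>
    (integrable_mul_mul (hc i j) (hW i j) _ _).1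

theorem abs_coeffForm_le
    (hc : ∀ i j, AEStronglyMeasurable (c i j) (volume.restrict Ω))
    (hW : ∀ i j, ∀ᵐ x ∂volume.restrict Ω, |c i j x| ≤ W)
    (hW0 : 0 ≤ W) (u v : H10 Ω) :
    |coeffForm c u v| ≤ d ^ 2 * W * ‖u‖ * ‖v‖ := by
  rw [coeffForm_eq_sum hc hW]
  calc |∑ i, ∑ j, ∫ x in Ω, c i j x * pd i u x * pd j v x|
      ≤ ∑ _i : Fin d, ∑ _j : Fin d, W * ‖u‖ * ‖v‖ := by
        refine (Finset.abs_sum_le_sum_abs _ _).trans (Finset.sum_le_sum fun i _ => ?_)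
        refine (Finset.abs_sum_le_sum_abs _ _).trans (Finset.sum_le_sum fun j _ => ?_)
        refine (integrable_mul_mul (hc i j) (hW i j) _ _).2.trans ?_
        have := norm_pd_le i u
        have := norm_pd_le j v
        gcongr
    _ = _ := by simp; ring

theorem coeffForm_add_left
    (hc : ∀ i j, AEStronglyMeasurable (c i j) (volume.restrict Ω))
    (hW : ∀ i j, ∀ᵐ x ∂volume.restrict Ω, |c i j x| ≤ W)
    (u u' v : H10 Ω) :
    coeffForm c (u + u') v = coeffForm c u v + coeffForm c u' v := by
  simp only [coeffForm_eq_sum hc hW, ← Finset.sum_add_distrib]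
  refine Finset.sum_congr rfl fun i _ => Finset.sum_congr rfl fun j _ => ?_
  rw [← integral_add (integrable_mul_mul (hc i j) (hW i j) _ _).1
    (integrable_mul_mul (hc i j) (hW i j) _ _).1]
  refine integral_congr_ae ?_
  filter_upwards [Lp.coeFn_add (pd i u) (pd i u')] with x hx
  rw [pd_add, hx, Pi.add_apply]; ring

theorem coeffForm_add_right
    (hc : ∀ i j, AEStronglyMeasurable (c i j) (volume.restrict Ω))
    (hW : ∀ i j, ∀ᵐ x ∂volume.restrict Ω, |c i j x| ≤ W)
    (u v v' : H10 Ω) :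
    coeffForm c u (v + v') = coeffForm c u v + coeffForm c u v' := by
  simp only [coeffForm_eq_sum hc hW, ← Finset.sum_add_distrib]
  refine Finset.sum_congr rfl fun i _ => Finset.sum_congr rfl fun j _ => ?_
  rw [← integral_add (integrable_mul_mul (hc i j) (hW i j) _ _).1
    (integrable_mul_mul (hc i j) (hW i j) _ _).1]
  refine integral_congr_ae ?_
  filter_upwards [Lp.coeFn_add (pd j v) (pd j v')] with x hx
  rw [pd_add, hx, Pi.add_apply]; ring

theorem coeffForm_smul_left
    (hc : ∀ i j, AEStronglyMeasurable (c i j) (volume.restrict Ω))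
    (hW : ∀ i j, ∀ᵐ x ∂volume.restrict Ω, |c i j x| ≤ W)
    (r : ℝ) (u v : H10 Ω) :
    coeffForm c (r • u) v = r * coeffForm c u v := by
  simp only [coeffForm_eq_sum hc hW, Finset.mul_sum]
  refine Finset.sum_congr rfl fun i _ => Finset.sum_congr rfl fun j _ => ?_
  rw [← integral_const_mul]
  refine integral_congr_ae ?_
  filter_upwards [Lp.coeFn_smul r (pd i u)] with x hx
  rw [pd_smul, hx, Pi.smul_apply, smul_eq_mul]; ring

theorem coeffForm_smul_right
    (hc : ∀ i j, AEStronglyMeasurable (c i j) (volume.restrict Ω))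
    (hW : ∀ i j, ∀ᵐ x ∂volume.restrict Ω, |c i j x| ≤ W)
    (r : ℝ) (u v : H10 Ω) :
    coeffForm c u (r • v) = r * coeffForm c u v := by
  simp only [coeffForm_eq_sum hc hW, Finset.mul_sum]
  refine Finset.sum_congr rfl fun i _ => Finset.sum_congr rfl fun j _ => ?_
  rw [← integral_const_mul]
  refine integral_congr_ae ?_
  filter_upwards [Lp.coeFn_smul r (pd j v)] with x hx
  rw [pd_smul, hx, Pi.smul_apply, smul_eq_mul]; ring

theorem le_coeffForm_self
    (hc : ∀ i j, AEStronglyMeasurable (c i j) (volume.restrict Ω))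
    (hW : ∀ i j, ∀ᵐ x ∂volume.restrict Ω, |c i j x| ≤ W)
    {α : ℝ} (hell : ∀ᵐ x ∂volume.restrict Ω, ∀ ξ : E d,
    α * ‖ξ‖ ^ 2 ≤ ∑ i, ∑ j, c i j x * ξ i * ξ j) (u : H10 Ω) :
    α * ∑ i, ‖pd i u‖ ^ 2 ≤ coeffForm c u u := by
  have hi : ∀ i, Integrable (fun x => (pd i u x) ^ 2) (volume.restrict Ω) := fun i => by
    simpa [pow_two] using MeasureTheory.L2.integrable_inner (𝕜 := ℝ) (pd i u) (pd i u)
  simp only [L2.norm_sq_eq_integral]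
  rw [← integral_finsetSum _ fun i _ => hi i, ← integral_const_mul]
  refine integral_mono_ae ((integrable_finsetSum _ fun i _ => hi i).const_mul _)
    (integrable_coeffForm hc hW u u) ?_
  filter_upwards [hell] with x hx
  simpa [EuclideanSpace.norm_sq_eq] using hx (WithLp.toLp 2 fun i => pd i u x)

end Bounded

theorem coeffForm_comm {c : Fin d → Fin d → E d → ℝ}
    (hs : ∀ i j, ∀ᵐ x ∂volume.restrict Ω, c i j x = c j i x) (u v : H10 Ω) :
    coeffForm c u v = coeffForm c v u := by
  refine integral_congr_ae ?_
  have : ∀ᵐ x ∂volume.restrict Ω, ∀ i j, c i j x = c j i x :=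
    ae_all_iff.2 fun i => ae_all_iff.2 fun j => hs i j
  filter_upwards [this] with x hx
  rw [Finset.sum_comm]
  refine Finset.sum_congr rfl fun i _ => Finset.sum_congr rfl fun j _ => ?_
  rw [hx j i]; ring

/-- The properties of the coefficients at almost every time. -/
structure IsRegularTime (Ω : Set (E d)) (α K : ℝ) (a : Fin d → Fin d → ℝ → E d → ℝ)
    (t : ℝ) : Prop where
  measurable : ∀ i j, AEStronglyMeasurable (a i j t) (volume.restrict Ω)
  bounded : ∀ i j, ∀ᵐ x ∂volume.restrict Ω, |a i j t x| ≤ K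
  symm : ∀ i j, ∀ᵐ x ∂volume.restrict Ω, a i j t x = a j i t x
  elliptic : ∀ᵐ x ∂volume.restrict Ω, ∀ ξ : E d,
    α * ‖ξ‖ ^ 2 ≤ ∑ i, ∑ j, a i j t x * ξ i * ξ j

/-- Fubini passes from almost every `(t, x)` to almost every `x` at almost every `t`; `K` sums all
the essential suprema so as to dominate each entry. -/
theorem IsCoeff.exists_isRegularTime {T α : ℝ} {ω : ℝ → ℝ} {a : Fin d → Fin d → ℝ → E d → ℝ}
    (ha : IsCoeff Ω T α ω a) :
    ∃ K, 0 ≤ K ∧ ∀ᵐ t ∂volume.restrict (Ioo 0 T), IsRegularTime Ω α K a t := by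
  let μ := (volume.restrict (Ioo 0 T)).prod (volume.restrict Ω)
  let κ : Fin d → Fin d → ℝ := fun i j => (eLpNorm (fun p : ℝ × E d => a i j p.1 p.2) ∞ μ).toReal
  have hκ : ∀ i j, 0 ≤ κ i j := fun i j => ENNReal.toReal_nonneg
  have hb : ∀ i j, ∀ᵐ p ∂μ, |a i j p.1 p.2| ≤ κ i j := fun i j => by
    have h := ha.bounded i j
    filter_upwards [ae_le_eLpNormEssSup (f := fun p : ℝ × E d => a i j p.1 p.2) (μ := μ)] with p hp
    rw [← eLpNorm_exponent_top] at hp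
    have := ENNReal.toReal_mono h.2.ne hp
    rwa [toReal_enorm, Real.norm_eq_abs] at this
  refine ⟨∑ i, ∑ j, κ i j, Finset.sum_nonneg fun i _ => Finset.sum_nonneg fun j _ => hκ i j, ?_⟩
  have h1 : ∀ᵐ t ∂volume.restrict (Ioo 0 T), ∀ i j,
      AEStronglyMeasurable (a i j t) (volume.restrict Ω) :=
    ae_all_iff.2 fun i => ae_all_iff.2 fun j => (ha.bounded i j).1.prodMk_left
  have h2 : ∀ᵐ t ∂volume.restrict (Ioo 0 T), ∀ i j, ∀ᵐ x ∂volume.restrict Ω,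
      |a i j t x| ≤ κ i j :=
    ae_all_iff.2 fun i => ae_all_iff.2 fun j => Measure.ae_ae_of_ae_prod (hb i j)
  have h3 : ∀ᵐ t ∂volume.restrict (Ioo 0 T), ∀ i j, ∀ᵐ x ∂volume.restrict Ω,
      a i j t x = a j i t x :=
    ae_all_iff.2 fun i => ae_all_iff.2 fun j => Measure.ae_ae_of_ae_prod (ha.symm i j)
  filter_upwards [h1, h2, h3, Measure.ae_ae_of_ae_prod ha.elliptic] with t t1 t2 t3 t4
  refine ⟨t1, fun i j => ?_, t3, t4⟩
  filter_upwards [t2 i j] with x hx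
  refine hx.trans ?_
  exact (Finset.single_le_sum (f := fun j => κ i j) (fun j _ => hκ i j) (Finset.mem_univ j)).trans
    (Finset.single_le_sum (f := fun i => ∑ j, κ i j)
      (fun i _ => Finset.sum_nonneg fun j _ => hκ i j) (Finset.mem_univ i))

theorem IsCoeff.aestronglyMeasurable_form {T α : ℝ} {ω : ℝ → ℝ}
    {a : Fin d → Fin d → ℝ → E d → ℝ} (ha : IsCoeff Ω T α ω a) (u v : H10 Ω) :
    AEStronglyMeasurable (fun t => form a t u v) (volume.restrict (Ioo 0 T)) := by
  have : AEStronglyMeasurable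
      (fun p : ℝ × E d => ∑ i, ∑ j, a i j p.1 p.2 * pd i u p.2 * pd j v p.2)
      ((volume.restrict (Ioo 0 T)).prod (volume.restrict Ω)) :=
    Finset.aestronglyMeasurable_fun_sum _ fun i _ => Finset.aestronglyMeasurable_fun_sum _
      fun j _ => (((ha.bounded i j).1.mul (Lp.aestronglyMeasurable (pd i u)).comp_snd).mul
        (Lp.aestronglyMeasurable (pd j v)).comp_snd)
  exact this.integral_prod_right'

theorem IsCoeff.abs_form_sub_le {T α K : ℝ} {ω : ℝ → ℝ}
    {a : Fin d → Fin d → ℝ → E d → ℝ} (ha : IsCoeff Ω T α ω a) (hω : IsModulus T ω)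
    {s t : ℝ} (hs : s ∈ Icc 0 T) (ht : t ∈ Icc 0 T) (hs' : IsRegularTime Ω α K a s)
    (ht' : IsRegularTime Ω α K a t) (u v : H10 Ω) :
    |form a s u v - form a t u v| ≤ d ^ 2 * ω |s - t| * ‖u‖ * ‖v‖ := by
  have hmem : |s - t| ∈ Icc 0 T :=
    ⟨abs_nonneg _, abs_le.2 ⟨by linarith [hs.1, ht.2], by linarith [hs.2, ht.1]⟩⟩
  have h := abs_coeffForm_le (c := fun i j x => a i j s x - a i j t x)
    (fun i j => (hs'.measurable i j).sub (ht'.measurable i j))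
    (fun i j => ha.modulus i j s hs t ht) (hω.nonneg _ hmem) u v
  convert h using 2
  rw [form, form, ← integral_sub (integrable_coeffForm hs'.measurable hs'.bounded u v)
    (integrable_coeffForm ht'.measurable ht'.bounded u v)]
  refine integral_congr_ae (Filter.Eventually.of_forall fun x => ?_)
  simp only [← Finset.sum_sub_distrib, sub_mul]

end Forms

/-! ### Averages over an interval. -/

section Average

theorem avg_le_of_ae_le {g : ℝ → ℝ} {p q C : ℝ} (hpq : p < q) (hg : IntegrableOn g (Ioc p q))
    (h : ∀ᵐ t ∂volume.restrict (Ioc p q), g t ≤ C) : (q - p)⁻¹ * ∫ t in p..q, g t ≤ C := by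
  have h1 : ∫ t in Ioc p q, g t ≤ ∫ _t in Ioc p q, C := integral_mono_ae hg (by simp) h
  rw [setIntegral_const, Real.volume_real_Ioc_of_le hpq.le, smul_eq_mul] at h1
  rw [intervalIntegral.integral_of_le hpq.le, inv_mul_le_iff₀ (by linarith)]
  exact h1

theorem le_avg_of_ae_le {g : ℝ → ℝ} {p q C : ℝ} (hpq : p < q) (hg : IntegrableOn g (Ioc p q))
    (h : ∀ᵐ t ∂volume.restrict (Ioc p q), C ≤ g t) : C ≤ (q - p)⁻¹ * ∫ t in p..q, g t := by
  have h1 : ∫ _t in Ioc p q, C ≤ ∫ t in Ioc p q, g t := integral_mono_ae (by simp) hg h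
  rw [setIntegral_const, Real.volume_real_Ioc_of_le hpq.le, smul_eq_mul] at h1
  rw [intervalIntegral.integral_of_le hpq.le, le_inv_mul_iff₀ (by linarith)]
  exact h1

theorem abs_avg_sub_le {g : ℝ → ℝ} {p q r W : ℝ} (hpq : p < q) (hg : IntegrableOn g (Ioc p q))
    (h : ∀ᵐ t ∂volume.restrict (Ioc p q), |g t - r| ≤ W) :
    |(q - p)⁻¹ * (∫ t in p..q, g t) - r| ≤ W := by
  rw [abs_sub_le_iff]
  have h1 := avg_le_of_ae_le (C := r + W) hpq hg
    (h.mono fun t ht => by linarith [(abs_sub_le_iff.1 ht).1])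
  have h2 := le_avg_of_ae_le (C := r - W) hpq hg
    (h.mono fun t ht => by linarith [(abs_sub_le_iff.1 ht).2])
  constructor <;> linarith

end Average

/-! ### Elementary properties of the mesh. -/

namespace Mesh

variable {T : ℝ} (τ : Mesh T)

theorem t_le_t {i j : ℕ} (hij : i ≤ j) (hj : j ≤ τ.M) : τ.t i ≤ τ.t j := by
  induction j, hij using Nat.le_induction with
  | base => exact le_rfl
  | succ j hij ih => exact (ih (by omega)).trans (τ.t_lt j (by omega)).le

theorem step_pos {m : ℕ} (hm : m ∈ Finset.Icc 1 τ.M) : 0 < τ.step m := by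
  obtain ⟨h1, h2⟩ := Finset.mem_Icc.1 hm
  have := τ.t_lt (m - 1) (by omega)
  rw [Nat.sub_add_cancel h1] at this
  exact sub_pos.2 this

theorem t_pred_lt {m : ℕ} (hm : m ∈ Finset.Icc 1 τ.M) : τ.t (m - 1) < τ.t m :=
  sub_pos.1 (τ.step_pos hm)

theorem Ioc_subset {m : ℕ} (hm : m ∈ Finset.Icc 1 τ.M) :
    Ioc (τ.t (m - 1)) (τ.t m) ⊆ Ioc 0 T := by
  obtain ⟨h1, h2⟩ := Finset.mem_Icc.1 hm
  have e1 := τ.t_le_t (Nat.zero_le (m - 1)) (by omega)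
  have e2 := τ.t_le_t h2 le_rfl
  rw [τ.t_zero] at e1
  rw [τ.t_last] at e2
  exact Ioc_subset_Ioc e1 e2

theorem restrict_Ioo_eq : volume.restrict (Ioo 0 T) = volume.restrict (Ioc 0 T) :=
  Measure.restrict_congr_set Ioo_ae_eq_Ioc

theorem ae_of_ae {m : ℕ} (hm : m ∈ Finset.Icc 1 τ.M) {Q : ℝ → Prop}
    (h : ∀ᵐ t ∂volume.restrict (Ioo 0 T), Q t) :
    ∀ᵐ t ∂volume.restrict (Ioc (τ.t (m - 1)) (τ.t m)), Q t ∧ t ∈ Ioc (τ.t (m - 1)) (τ.t m) := by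
  rw [restrict_Ioo_eq] at h
  exact (ae_restrict_of_ae_restrict_of_subset (τ.Ioc_subset hm) h).and
    (ae_restrict_mem measurableSet_Ioc)

theorem step_le_k {m : ℕ} (hm : m ∈ Finset.Icc 1 τ.M) : τ.step m ≤ τ.k :=
  Finset.le_sup' (f := τ.step) hm

theorem kmin_le_step {m : ℕ} (hm : m ∈ Finset.Icc 1 τ.M) : τ.kmin ≤ τ.step m :=
  Finset.inf'_le (f := τ.step) hm

theorem le_maxOver (g : ℕ → ℝ) {m : ℕ} (hm : m ∈ Finset.Icc 1 τ.M) : g m ≤ τ.maxOver g :=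
  Finset.le_sup' (f := g) hm

theorem k_pos : 0 < τ.k :=
  (τ.step_pos (m := 1) (by simp [τ.M_pos])).trans_le (τ.step_le_k (by simp [τ.M_pos]))

end Mesh

/-! ### The averaged forms. -/

section AvgForm

variable {d : ℕ} {Ω : Set (E d)} {T α : ℝ} {ω : ℝ → ℝ} {a : Fin d → Fin d → ℝ → E d → ℝ}

theorem IsCoeff.integrableOn_form (ha : IsCoeff Ω T α ω a) {K : ℝ} (hK0 : 0 ≤ K)
    (hK : ∀ᵐ t ∂volume.restrict (Ioo 0 T), IsRegularTime Ω α K a t) (u v : H10 Ω) :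
    IntegrableOn (fun t => form a t u v) (Ioc 0 T) := by
  have h : IntegrableOn (fun t => form a t u v) (Ioo 0 T) := by
    refine IntegrableOn.of_bound (by simp) (ha.aestronglyMeasurable_form u v)
      (d ^ 2 * K * ‖u‖ * ‖v‖) ?_
    filter_upwards [hK] with t ht
    exact abs_coeffForm_le ht.measurable ht.bounded hK0 u v
  rwa [IntegrableOn, Mesh.restrict_Ioo_eq] at h

/-- The averaged forms `⟨A_{k,m} u, v⟩` as bounded bilinear forms: they are symmetric and coercive,
and vary in `m` with the modulus of continuity of the coefficients. -/
theorem exists_avgForm (hω : IsModulus T ω) (ha : IsCoeff Ω T α ω a) (hα : 0 < α) {P : ℝ}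
    (hP : 0 ≤ P) (hpoin : ∀ u : H10 Ω, ‖val u‖ ^ 2 ≤ P * ∑ i, ‖pd i u‖ ^ 2) (τ : Mesh T) :
    ∃ b : ℕ → BoundedForm (H10 Ω), ∀ m ∈ Finset.Icc 1 τ.M,
      (∀ u v, b m u v = avgA τ a m u v) ∧ (∀ u v, b m u v = b m v u) ∧
      (∀ u, α / (P + 1) * ‖u‖ ^ 2 ≤ b m u u) ∧
      ∀ j ∈ Finset.Icc 1 τ.M, j < m → ∀ u v,
        |b m u v - b j u v| ≤ d ^ 2 * ω (τ.t m - τ.t (j - 1)) * ‖u‖ * ‖v‖ := by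
  obtain ⟨K, hK0, hK⟩ := ha.exists_isRegularTime
  have hi : ∀ m ∈ Finset.Icc 1 τ.M, ∀ u v : H10 Ω,
      IntegrableOn (fun t => form a t u v) (Ioc (τ.t (m - 1)) (τ.t m)) := fun m hm u v =>
    (ha.integrableOn_form hK0 hK u v).mono_set (τ.Ioc_subset hm)
  have hae := fun m (hm : m ∈ Finset.Icc 1 τ.M) => τ.ae_of_ae hm hK
  have hI : ∀ m ∈ Finset.Icc 1 τ.M, ∀ u v : H10 Ω,
      avgA τ a m u v = (τ.step m)⁻¹ * ∫ t in Ioc (τ.t (m - 1)) (τ.t m), form a t u v :=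
    fun m hm u v => by rw [avgA, intervalIntegral.integral_of_le (τ.t_pred_lt hm).le]
  have hex : ∀ m, ∃ b : BoundedForm (H10 Ω), m ∈ Finset.Icc 1 τ.M →
      ∀ u v, b u v = avgA τ a m u v := by
    intro m
    by_cases hm : m ∈ Finset.Icc 1 τ.M
    swap
    · exact ⟨0, fun h => absurd h hm⟩
    let L : H10 Ω →ₗ[ℝ] H10 Ω →ₗ[ℝ] ℝ := LinearMap.mk₂ ℝ (avgA τ a m)
      (fun u u' v => by
        rw [hI m hm, hI m hm, hI m hm, ← mul_add, ← integral_add (hi m hm u v) (hi m hm u' v)]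
        congr 1
        refine integral_congr_ae ((hae m hm).mono fun t ht => ?_)
        exact coeffForm_add_left ht.1.measurable ht.1.bounded u u' v)
      (fun r u v => by
        rw [hI m hm, hI m hm, smul_eq_mul, mul_left_comm, ← integral_const_mul r]
        congr 1
        refine integral_congr_ae ((hae m hm).mono fun t ht => ?_)
        exact coeffForm_smul_left ht.1.measurable ht.1.bounded r u v)
      (fun u v v' => by
        rw [hI m hm, hI m hm, hI m hm, ← mul_add, ← integral_add (hi m hm u v) (hi m hm u v')]
        congr 1
        refine integral_congr_ae ((hae m hm).mono fun t ht => ?_)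
        exact coeffForm_add_right ht.1.measurable ht.1.bounded u v v')
      (fun r u v => by
        rw [hI m hm, hI m hm, smul_eq_mul, mul_left_comm, ← integral_const_mul r]
        congr 1
        refine integral_congr_ae ((hae m hm).mono fun t ht => ?_)
        exact coeffForm_smul_right ht.1.measurable ht.1.bounded r u v)
    refine ⟨L.mkContinuous₂ (d ^ 2 * K) fun u v => ?_, fun _ u v => rfl⟩
    have := abs_avg_sub_le (r := 0) (W := d ^ 2 * K * ‖u‖ * ‖v‖) (τ.t_pred_lt hm) (hi m hm u v)
      ((hae m hm).mono fun t ht => by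
        rw [sub_zero]; exact abs_coeffForm_le ht.1.measurable ht.1.bounded hK0 u v)
    rw [sub_zero] at this
    exact this
  choose b hb using hex
  refine ⟨b, fun m hm => ⟨hb m hm, fun u v => ?_, fun u => ?_, fun j hj hjm u v => ?_⟩⟩
  · rw [hb m hm, hb m hm, hI m hm, hI m hm]
    congr 1
    exact integral_congr_ae ((hae m hm).mono fun t ht => coeffForm_comm ht.1.symm u v)
  · rw [hb m hm]
    refine le_avg_of_ae_le (τ.t_pred_lt hm) (hi m hm u u) ((hae m hm).mono fun t ht => ?_)
    refine le_trans ?_ (le_coeffForm_self ht.1.measurable ht.1.bounded ht.1.elliptic u)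
    -- Poincaré converts coercivity in the gradient into coercivity in the full norm, with constant
    -- `α / (P + 1)`.
    have := hpoin u
    rw [norm_sq_eq, div_mul_eq_mul_div, div_le_iff₀ (by linarith)]
    nlinarith
  · rw [hb m hm, hb j hj]
    -- Two nested averages: `s` runs over `I_m` and, for fixed `s`, `t` runs over `I_j`, where `|t -
    -- s| ≤ t_m - t_{j-1}`.
    refine abs_avg_sub_le (τ.t_pred_lt hm) (hi m hm u v) ((hae m hm).mono fun s hs => ?_)
    rw [abs_sub_comm]
    refine abs_avg_sub_le (τ.t_pred_lt hj) (hi j hj u v) ((hae j hj).mono fun t ht => ?_)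
    have hs' := τ.Ioc_subset hm hs.2
    have ht' := τ.Ioc_subset hj ht.2
    refine (ha.abs_form_sub_le hω ⟨ht'.1.le, ht'.2⟩ ⟨hs'.1.le, hs'.2⟩ ht.1 hs.1 u v).trans ?_
    have hle : τ.t j ≤ τ.t (m - 1) := τ.t_le_t (by omega) (by have := Finset.mem_Icc.1 hm; omega)
    have hdist : |t - s| ≤ τ.t m - τ.t (j - 1) :=
      abs_le.2 ⟨by linarith [hs.2.2, ht.2.1], by linarith [hs.2.1, ht.2.2, hs.2.2, ht.2.1]⟩
    have hT : τ.t m - τ.t (j - 1) ≤ T := by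
      have e1 := τ.t_le_t (Nat.zero_le (j - 1)) (by have := Finset.mem_Icc.1 hj; omega)
      have e2 := τ.t_le_t (Finset.mem_Icc.1 hm).2 le_rfl
      rw [τ.t_zero] at e1
      rw [τ.t_last] at e2
      linarith
    have := hω.mono ⟨abs_nonneg _, hdist.trans hT⟩ ⟨(abs_nonneg _).trans hdist, hT⟩ hdist
    gcongr

end AvgForm

/-! ### A priori bounds for the implicit Euler scheme. -/

section Evolution

variable {V H : Type*} [NormedAddCommGroup V] [InnerProductSpace ℝ V]
  [NormedAddCommGroup H] [InnerProductSpace ℝ H] {T : ℝ}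

theorem Mesh.sum_range_step (τ : Mesh T) {m : ℕ} (i : ℕ) (hi : i ≤ m) :
    ∑ l ∈ Finset.range i, (if l < m then τ.step (m - l) else 1) = τ.t m - τ.t (m - i) := by
  induction i with
  | zero => simp
  | succ i ih =>
    rw [Finset.sum_range_succ, ih (by omega), if_pos (by omega), Mesh.step,
      show m - i - 1 = m - (i + 1) by omega]
    ring

theorem Mesh.t_sub_t_le (τ : Mesh T) {i j : ℕ} (hj : j ≤ τ.M) (hi : i ≤ τ.M) :
    τ.t j - τ.t i ≤ T := by
  have e1 := τ.t_le_t (Nat.zero_le i) hi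
  have e2 := τ.t_le_t hj le_rfl
  rw [τ.t_zero] at e1
  rw [τ.t_last] at e2
  linarith

/-- Pointwise bound of `v m = A_m U_m` for an implicit Euler scheme, given a bound `R` for `U` in
the form domain. -/
theorem norm_le_of_evolution [CompleteSpace V] (hT : 0 < T) (τ : Mesh T) {ω : ℝ → ℝ}
    (hω : IsModulus T ω) (ι : V →L[ℝ] H) (b : ℕ → V →L[ℝ] V →L[ℝ] ℝ) {α κ : ℝ} (hα : 0 < α)
    (hκ : 0 < κ)
    (hratio : ∀ m ∈ Finset.Icc 1 (τ.M - 1),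
      κ⁻¹ ≤ τ.step m / τ.step (m + 1) ∧ τ.step m / τ.step (m + 1) ≤ κ)
    (hb : ∀ m ∈ Finset.Icc 1 τ.M, ∀ u, α * ‖u‖ ^ 2 ≤ b m u u)
    (hs : ∀ m ∈ Finset.Icc 1 τ.M, ∀ u v, b m u v = b m v u) {ρ : ℝ} (hρ : 0 ≤ ρ)
    (hdiff : ∀ m ∈ Finset.Icc 1 τ.M, ∀ j ∈ Finset.Icc 1 τ.M, j < m → ∀ u v,
      |b m u v - b j u v| ≤ ρ * ω (τ.t m - τ.t (j - 1)) * ‖u‖ * ‖v‖)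
    {U : ℕ → V} {v f g : ℕ → H}
    (hv : ∀ m ∈ Finset.Icc 1 τ.M, ∀ w, b m (U m) w = inner ℝ (v m) (ι w))
    (hstep : ∀ m ∈ Finset.Icc 1 τ.M,
      τ.step m • v m = τ.step m • f m - (ι (U m) - ι (U (m - 1))))
    (hg : ∀ m ∈ Finset.Icc 1 τ.M, ∀ w, b m (U 0) w = inner ℝ (g m) (ι w)) {F G R : ℝ}
    (hF : ∀ m ∈ Finset.Icc 1 τ.M, ‖f m‖ ≤ F) (hG : ∀ m ∈ Finset.Icc 1 τ.M, ‖g m‖ ≤ G)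
    (hR : ∀ m ∈ Finset.Icc 1 τ.M, ‖U m‖ ≤ R) {m : ℕ} (hm : m ∈ Finset.Icc 1 τ.M) :
    ‖v m‖ ≤ G + F * (1 + Real.log (T / τ.kmin))
      + √((2 * κ + 2) / α) * (ρ * (∫ s in Ioc 0 T, ω s / s ^ (3 / 2 : ℝ)) * R) := by
  obtain ⟨hm1, hmM⟩ := Finset.mem_Icc.1 hm
  obtain ⟨N, rfl⟩ : ∃ N, m = N + 1 := ⟨m - 1, by omega⟩
  have hF0 : 0 ≤ F := (norm_nonneg _).trans (hF _ hm)
  have hR0 : 0 ≤ R := (norm_nonneg _).trans (hR _ hm)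
  have hmem : ∀ i ≤ N, N + 1 - i ∈ Finset.Icc 1 τ.M := fun i hi =>
    Finset.mem_Icc.2 ⟨by omega, by omega⟩
  -- Steps in reversed order, from `I_m` back to `I_1`; the value 1 beyond them only keeps the
  -- infinite sequence positive.
  let k : ℕ → ℝ := fun l => if l < N + 1 then τ.step (N + 1 - l) else 1
  have hkeq : ∀ i ≤ N, k i = τ.step (N + 1 - i) := fun i hi => if_pos (by omega)
  have hk : ∀ i, 0 < k i := fun i => by
    by_cases hi : i < N + 1
    · rw [hkeq i (by omega)]; exact τ.step_pos (hmem i (by omega))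
    · have h1 : k i = 1 := if_neg hi
      rw [h1]; exact one_pos
  have hsum : ∀ i ≤ N + 1, ∑ l ∈ Finset.range i, k l = τ.t (N + 1) - τ.t (N + 1 - i) :=
    τ.sum_range_step
  have hrat : ∀ i, i + 1 < N + 1 → k (i + 1) ≤ κ * k i ∧ k i ≤ κ * k (i + 1) := fun i hi => by
    have h := hratio (N - i) (Finset.mem_Icc.2 ⟨by omega, by omega⟩)
    have e1 : k (i + 1) = τ.step (N - i) := by
      rw [hkeq _ (by omega)]; congr 1; omega
    have e2 : k i = τ.step (N - i + 1) := by
      rw [hkeq _ (by omega)]; congr 1; omega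
    have p1 := hk i
    rw [← e1, ← e2, div_le_iff₀ p1, le_div_iff₀ p1, inv_mul_le_iff₀ hκ] at h
    exact ⟨h.2, h.1⟩
  have key := norm_le_of_duhamel ι (fun i => b (N + 1 - i)) hk hα (hb _ hm) (hs _ hm)
    (U := fun i => U (N + 1 - i)) (v := fun i => v (N + 1 - i)) (f := fun i => f (N + 1 - i)) N hκ
    (fun h => (hrat 0 (by omega)).2) (fun i hi => (hrat i hi).1)
    (fun i hi w => hv _ (hmem i hi) w)
    (fun i hi => by
      rw [hkeq i hi]
      have := hstep _ (hmem i hi)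
      rwa [show N + 1 - i - 1 = N + 1 - (i + 1) by omega] at this)
    (g := g (N + 1)) (fun w => by simpa using hg _ hm w) (fun i hi => hF _ (hmem i hi))
    -- The `i + 2` steps reach from `t_m` back to the left end of the interval of `U (i + 1)`,
    -- matching the distance in `hdiff`.
    (W := fun i => ρ * ω (∑ l ∈ Finset.range (i + 2), k l))
    (fun i hi u w => by
      have := hdiff _ hm _ (hmem (i + 1) (by omega)) (by omega) u w
      rw [hsum _ (by omega)]
      rwa [show N + 1 - (i + 1) - 1 = N + 1 - (i + 2) by omega] at this)
  simp only [Nat.sub_zero] at key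
  have hsN : ∑ l ∈ Finset.range (N + 1), k l ≤ T := by
    rw [hsum _ le_rfl]; exact τ.t_sub_t_le hmM (by omega)
  have t1 : ∑ i ∈ Finset.range (N + 1), k i / ∑ l ∈ Finset.range (i + 1), k l ≤
      1 + Real.log (T / τ.kmin) := by
    refine (sum_div_sum_le_log hk N).trans ?_
    have p1 := sum_range_succ_pos hk N
    have p2 := hk 0
    have p3 : τ.kmin ≤ k 0 := by
      rw [hkeq 0 (by omega)]; exact τ.kmin_le_step (hmem 0 (by omega))
    have p4 : 0 < τ.kmin := (Finset.lt_inf'_iff _).2 fun j hj => τ.step_pos hj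
    gcongr
  have hω0 : ∀ s ∈ Ioc 0 T, 0 ≤ ω s / s ^ (3 / 2 : ℝ) := fun s hs =>
    div_nonneg (hω.nonneg s ⟨hs.1.le, hs.2⟩) (Real.rpow_nonneg hs.1.le _)
  have t2 : ∑ i ∈ Finset.range N, k (i + 1) * (ρ * ω (∑ l ∈ Finset.range (i + 2), k l) /
      (∑ l ∈ Finset.range (i + 2), k l) ^ (3 / 2 : ℝ)) * ‖U (N + 1 - (i + 1))‖ ≤
      ρ * (∫ s in Ioc 0 T, ω s / s ^ (3 / 2 : ℝ)) * R := by
    have h := sum_mul_le_integral hk hω0 hω.anti hω.integrable N hsN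
    calc _ ≤ ∑ i ∈ Finset.range N, ρ * (k (i + 1) * (ω (∑ l ∈ Finset.range (i + 2), k l) /
        (∑ l ∈ Finset.range (i + 2), k l) ^ (3 / 2 : ℝ))) * R := by
          refine Finset.sum_le_sum fun i hi => ?_
          have hi' : i < N := by simpa using hi
          have p1 := hk (i + 1)
          have p2 := sum_range_succ_pos hk (i + 1)
          have p3 := hω0 (∑ l ∈ Finset.range (i + 2), k l) ⟨p2, by
            rw [hsum _ (by omega)]; exact τ.t_sub_t_le hmM (by omega)⟩
          have p4 := hR _ (hmem (i + 1) (by omega))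
          rw [mul_div_assoc, mul_left_comm]
          gcongr
      _ = ρ * (∑ i ∈ Finset.range N, k (i + 1) * (ω (∑ l ∈ Finset.range (i + 2), k l) /
        (∑ l ∈ Finset.range (i + 2), k l) ^ (3 / 2 : ℝ))) * R := by
          rw [Finset.mul_sum, Finset.sum_mul]
      _ ≤ _ := by gcongr
  have := hG _ hm
  refine key.trans ?_
  gcongr

/-- Testing the scheme with `U m` and discarding the nonnegative form gives growth by at most `k_m
F` per step. -/
theorem norm_le_of_energy (τ : Mesh T) (ι : V →L[ℝ] H) (b : ℕ → V →L[ℝ] V →L[ℝ] ℝ)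
    (hb : ∀ m ∈ Finset.Icc 1 τ.M, ∀ u, 0 ≤ b m u u) {U : ℕ → V} {v f : ℕ → H}
    (hv : ∀ m ∈ Finset.Icc 1 τ.M, ∀ w, b m (U m) w = inner ℝ (v m) (ι w))
    (hstep : ∀ m ∈ Finset.Icc 1 τ.M,
      τ.step m • v m = τ.step m • f m - (ι (U m) - ι (U (m - 1)))) {F : ℝ}
    (hF : ∀ m ∈ Finset.Icc 1 τ.M, ‖f m‖ ≤ F) (m : ℕ) (hm : m ≤ τ.M) :
    ‖ι (U m)‖ ≤ ‖ι (U 0)‖ + τ.t m * F := by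
  induction m with
  | zero => simp [τ.t_zero]
  | succ m ih =>
    have ih := ih (by omega)
    have hmem : m + 1 ∈ Finset.Icc 1 τ.M := Finset.mem_Icc.2 ⟨by omega, hm⟩
    have hk := τ.step_pos hmem
    have h1 := congrArg (fun w => inner ℝ w (ι (U (m + 1)))) (hstep _ hmem)
    simp only [inner_smul_left, inner_sub_left, RCLike.conj_to_real, ← hv _ hmem,
      add_tsub_cancel_right] at h1
    rw [real_inner_self_eq_norm_sq] at h1
    have h2 := mul_nonneg hk.le (hb _ hmem (U (m + 1)))
    have h3 := real_inner_le_norm (f (m + 1)) (ι (U (m + 1)))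
    have h4 := real_inner_le_norm (ι (U m)) (ι (U (m + 1)))
    have h5 := hF _ hmem
    have h6 : τ.step (m + 1) * inner ℝ (f (m + 1)) (ι (U (m + 1))) ≤
        τ.step (m + 1) * (F * ‖ι (U (m + 1))‖) := by
      gcongr; exact h3.trans (by gcongr)
    have h7 : ‖ι (U (m + 1))‖ ≤ ‖ι (U m)‖ + τ.step (m + 1) * F := by
      by_contra! hlt
      have hF0 : 0 ≤ F := (norm_nonneg _).trans h5
      have hpos : 0 < ‖ι (U (m + 1))‖ := lt_of_le_of_lt (by positivity) hlt
      nlinarith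
    have e : τ.step (m + 1) = τ.t (m + 1) - τ.t m := by simp [Mesh.step]
    rw [e] at h7
    linarith

/-- Coercivity gives `α ‖u‖² ≤ ‖v‖ ‖ι u‖`; the arithmetic-geometric mean inequality splits the
product with weight `ε`. -/
theorem norm_le_eps_mul_add {ι : V →L[ℝ] H} {b : V →L[ℝ] V →L[ℝ] ℝ} {α : ℝ} (hα : 0 < α)
    (hb : ∀ u, α * ‖u‖ ^ 2 ≤ b u u) {u : V} {v : H} (hv : ∀ w, b u w = inner ℝ v (ι w)) {ε : ℝ}
    (hε : 0 < ε) : ‖u‖ ≤ ε * ‖v‖ + (4 * ε * α)⁻¹ * ‖ι u‖ := by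
  have h1 : α * ‖u‖ ^ 2 ≤ ‖v‖ * ‖ι u‖ := (hb u).trans (by rw [hv]; exact real_inner_le_norm _ _)
  refine abs_le_of_sq_le_sq' ?_ (by positivity) |>.2
  have h2 : ‖u‖ ^ 2 ≤ 4 * (ε * ‖v‖) * ((4 * ε * α)⁻¹ * ‖ι u‖) := by
    have : 4 * (ε * ‖v‖) * ((4 * ε * α)⁻¹ * ‖ι u‖) = ‖v‖ * ‖ι u‖ / α := by field_simp
    rw [this, le_div_iff₀ hα]; linarith
  nlinarith [sq_nonneg (ε * ‖v‖ - (4 * ε * α)⁻¹ * ‖ι u‖)]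

theorem norm_le_inv_mul_of_coercive {ι : V →L[ℝ] H} {b : V →L[ℝ] V →L[ℝ] ℝ} {α : ℝ} (hα : 0 < α)
    (hb : ∀ u, α * ‖u‖ ^ 2 ≤ b u u) (hι : ∀ u, ‖ι u‖ ≤ ‖u‖) {u : V} {g : H}
    (hg : ∀ w, b u w = inner ℝ g (ι w)) : ‖ι u‖ ≤ α⁻¹ * ‖g‖ := by
  have h1 : α * ‖u‖ ^ 2 ≤ ‖g‖ * ‖u‖ := by
    refine (hb u).trans ?_
    rw [hg]
    exact (real_inner_le_norm _ _).trans (by gcongr; exact hι u)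
  refine (hι u).trans ?_
  rw [le_inv_mul_iff₀ hα]
  by_contra! hlt
  have hpos : 0 < ‖u‖ := by
    by_contra! h0
    rw [le_antisymm h0 (norm_nonneg u), mul_zero] at hlt
    exact absurd hlt (norm_nonneg g).not_gt
  nlinarith

end Evolution

/-! ### From the variational formulation to the time-stepping scheme. -/

section Scheme

variable {d : ℕ} {Ω : Set (E d)} {T : ℝ}

/-- The average of `f` over `I_m`. -/
def avgRhs (τ : Mesh T) (f : ℝ → L2 Ω) (m : ℕ) : L2 Ω :=
  (τ.step m)⁻¹ • ∫ t in (τ.t (m - 1))..(τ.t m), f t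

theorem integrableOn_of_memLp_top {f : ℝ → L2 Ω} (hf : MemLp f ∞ (volume.restrict (Ioo 0 T))) :
    IntegrableOn f (Ioc 0 T) := by
  rw [IntegrableOn, ← Mesh.restrict_Ioo_eq]
  exact hf.integrable (by simp)

theorem step_mul_inner_avgRhs (τ : Mesh T) {f : ℝ → L2 Ω}
    (hf : MemLp f ∞ (volume.restrict (Ioo 0 T))) {m : ℕ} (hm : m ∈ Finset.Icc 1 τ.M) (w : L2 Ω) :
    τ.step m * inner ℝ (avgRhs τ f m) w = ∫ t in (τ.t (m - 1))..(τ.t m), inner ℝ (f t) w := by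
  have hi := (integrableOn_of_memLp_top hf).mono_set (τ.Ioc_subset hm)
  rw [avgRhs, inner_smul_left, RCLike.conj_to_real, mul_inv_cancel_left₀ (τ.step_pos hm).ne',
    intervalIntegral.integral_of_le (τ.t_pred_lt hm).le,
    intervalIntegral.integral_of_le (τ.t_pred_lt hm).le, real_inner_comm, ← integral_inner hi]
  simp only [real_inner_comm]

theorem norm_avgRhs_le (τ : Mesh T) {f : ℝ → L2 Ω}
    (hf : MemLp f ∞ (volume.restrict (Ioo 0 T))) {m : ℕ} (hm : m ∈ Finset.Icc 1 τ.M) :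
    ‖avgRhs τ f m‖ ≤ (eLpNorm f ∞ (volume.restrict (Ioo 0 T))).toReal := by
  have hb : ∀ᵐ t ∂volume.restrict (Ioo 0 T),
      ‖f t‖ ≤ (eLpNorm f ∞ (volume.restrict (Ioo 0 T))).toReal := by
    filter_upwards [ae_le_eLpNormEssSup (f := f) (μ := volume.restrict (Ioo 0 T))] with t ht
    rw [← eLpNorm_exponent_top] at ht
    have := ENNReal.toReal_mono hf.2.ne ht
    rwa [toReal_enorm] at this
  have h1 := τ.ae_of_ae hm hb
  have hk := τ.step_pos hm
  rw [avgRhs, norm_smul, Real.norm_of_nonneg (inv_nonneg.2 hk.le), inv_mul_le_iff₀ hk,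
    intervalIntegral.integral_of_le (τ.t_pred_lt hm).le]
  have h2 := norm_integral_le_of_norm_le_const (h1.mono fun t ht => ht.1)
  rw [measureReal_restrict_apply_univ, Real.volume_real_Ioc_of_le (τ.t_pred_lt hm).le] at h2
  rw [mul_comm]
  exact h2

theorem IsSolution.step_equation {τ : Mesh T} {a : Fin d → Fin d → ℝ → E d → ℝ} {f : ℝ → L2 Ω}
    {u₀ : L2 Ω} {u : ℕ → H10 Ω} (hu : IsSolution τ a f u₀ u)
    (hf : MemLp f ∞ (volume.restrict (Ioo 0 T))) {b : ℕ → BoundedForm (H10 Ω)}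
    (hb : ∀ m ∈ Finset.Icc 1 τ.M, ∀ u v, b m u v = avgA τ a m u v)
    {m : ℕ} (hm : m ∈ Finset.Icc 1 τ.M) (w : H10 Ω) :
    τ.step m * b m (u m) w + inner ℝ (jumpBefore u₀ u m) (val w) =
      τ.step m * inner ℝ (avgRhs τ f m) (val w) := by
  have hform : ∀ n ∈ Finset.Icc 1 τ.M, ∀ u v : H10 Ω,
      ∫ t in (τ.t (n - 1))..(τ.t n), form a t u v = τ.step n * b n u v := fun n hn u v => by
    rw [hb n hn, avgA, mul_inv_cancel_left₀ (τ.step_pos hn).ne']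
  have h0 : val (0 : H10 Ω) = 0 := rfl
  have hne : ∀ n, n ≠ m → (Pi.single m w : ℕ → H10 Ω) n = 0 := fun n hn => by simp [hn]
  -- Testing with a function supported in `I_m` isolates one time step.
  have h := hu (Pi.single m w)
  have s1 : ∑ n ∈ Finset.Icc 1 τ.M, ∫ t in (τ.t (n - 1))..(τ.t n),
      form a t (u n) ((Pi.single m w : ℕ → H10 Ω) n) = τ.step m * b m (u m) w := by
    rw [Finset.sum_eq_single_of_mem m hm fun n hn hnm => by
      rw [hform n hn, hne n hnm, map_zero, mul_zero], hform m hm, Pi.single_eq_same]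
  have s2 : ∑ n ∈ Finset.Icc 1 τ.M, ∫ t in (τ.t (n - 1))..(τ.t n),
      inner ℝ (f t) (val ((Pi.single m w : ℕ → H10 Ω) n)) =
      τ.step m * inner ℝ (avgRhs τ f m) (val w) := by
    rw [Finset.sum_eq_single_of_mem m hm fun n hn hnm => by
      rw [hne n hnm, h0]; simp, Pi.single_eq_same, step_mul_inner_avgRhs τ hf hm]
  rw [B, s1, s2] at h
  by_cases h1 : m = 1
  · subst h1
    rw [Finset.sum_eq_zero fun n hn => by
      rw [hne n (by have := (Finset.mem_Icc.1 hn).1; omega), h0, inner_zero_right],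
      Pi.single_eq_same] at h
    rw [jumpBefore, if_pos rfl, inner_sub_left]
    linarith
  · rw [Finset.sum_eq_single_of_mem m (Finset.mem_Icc.2
        ⟨by have := (Finset.mem_Icc.1 hm).1; omega, (Finset.mem_Icc.1 hm).2⟩) fun n hn hnm => by
      rw [hne n hnm, h0, inner_zero_right], Pi.single_eq_same, hne 1 (Ne.symm h1), h0,
      inner_zero_right, inner_zero_right] at h
    rw [jumpBefore, if_neg h1]
    linarith

end Scheme

/-! ### Absorption and final constants. -/

/-- `1 ≤ ln (T / k)` and `1 + ln (T / k_min) ≤ Λ ln (T / k)` on admissible meshes. -/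
theorem Mesh.Admissible.log_bounds {T c β κ : ℝ} (hT : 0 < T) (hc : 0 < c)
    {τ : Mesh T} (hτ : τ.Admissible c β κ) :
    1 ≤ Real.log (T / τ.k) ∧ 1 + Real.log (T / τ.kmin) ≤
      (1 + |(1 - β) * Real.log T - Real.log c| + β) * Real.log (T / τ.k) := by
  have hk := τ.k_pos
  have h4 : 4 ≤ T / τ.k := by rw [le_div_iff₀ hk]; linarith [hτ.le_quarter]
  have h1 : 1 ≤ Real.log (T / τ.k) := by
    rw [Real.le_log_iff_exp_le (by positivity)]
    linarith [Real.exp_one_lt_d9]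
  have hck : 0 < c * τ.k ^ β := by positivity
  have hle : Real.log (T / τ.kmin) ≤ Real.log (T / (c * τ.k ^ β)) :=
    Real.log_le_log (div_pos hT (hck.trans_le hτ.min_ge))
      (div_le_div_of_nonneg_left hT.le hck hτ.min_ge)
  rw [Real.log_div hT.ne' hck.ne', Real.log_mul hc.ne' (by positivity), Real.log_rpow hk] at hle
  have he := Real.log_div hT.ne' hk.ne'
  refine ⟨h1, ?_⟩
  have habs := le_abs_self ((1 - β) * Real.log T - Real.log c)
  have hnn := abs_nonneg ((1 - β) * Real.log T - Real.log c)
  set A := |(1 - β) * Real.log T - Real.log c|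
  set L := Real.log (T / τ.k)
  -- The bound on `log (T / k_min)` equals `(1 - β) log T - log c + β L`; since `L ≥ 1`, the
  -- constant part is also a multiple of `L`.
  have : A ≤ A * L := le_mul_of_one_le_right hnn h1
  have e2 : Real.log τ.k = Real.log T - L := by linarith
  rw [e2] at hle
  linarith

theorem le_of_absorb {X B Q ε Z : ℝ} (h : X ≤ B + Q * (ε * X + Z)) (hX : 0 ≤ X)
    (hQ : Q * ε ≤ 1 / 2) : X ≤ 2 * (B + Q * Z) := by
  have : Q * ε * X ≤ 1 / 2 * X := by gcongr
  linarith

/-- The bound of `norm_le_of_evolution` closed by absorbing the form norms of `U`. -/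
theorem norm_le_of_evolution_absorbed {V H : Type*} [NormedAddCommGroup V] [InnerProductSpace ℝ V]
    [NormedAddCommGroup H] [InnerProductSpace ℝ H] [CompleteSpace V] {T : ℝ} (hT : 0 < T)
    (τ : Mesh T) {ω : ℝ → ℝ} (hω : IsModulus T ω) (ι : V →L[ℝ] H) (hι : ∀ u, ‖ι u‖ ≤ ‖u‖)
    (b : ℕ → V →L[ℝ] V →L[ℝ] ℝ) {γ κ : ℝ} (hγ : 0 < γ) (hκ : 0 < κ)
    (hratio : ∀ m ∈ Finset.Icc 1 (τ.M - 1),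
      κ⁻¹ ≤ τ.step m / τ.step (m + 1) ∧ τ.step m / τ.step (m + 1) ≤ κ)
    (hb : ∀ m ∈ Finset.Icc 1 τ.M, ∀ u, γ * ‖u‖ ^ 2 ≤ b m u u)
    (hs : ∀ m ∈ Finset.Icc 1 τ.M, ∀ u v, b m u v = b m v u) {ρ : ℝ} (hρ : 0 ≤ ρ)
    (hdiff : ∀ m ∈ Finset.Icc 1 τ.M, ∀ j ∈ Finset.Icc 1 τ.M, j < m → ∀ u v,
      |b m u v - b j u v| ≤ ρ * ω (τ.t m - τ.t (j - 1)) * ‖u‖ * ‖v‖)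
    {U : ℕ → V} {v f g : ℕ → H}
    (hv : ∀ m ∈ Finset.Icc 1 τ.M, ∀ w, b m (U m) w = inner ℝ (v m) (ι w))
    (hstep : ∀ m ∈ Finset.Icc 1 τ.M,
      τ.step m • v m = τ.step m • f m - (ι (U m) - ι (U (m - 1))))
    (hg : ∀ m ∈ Finset.Icc 1 τ.M, ∀ w, b m (U 0) w = inner ℝ (g m) (ι w)) {F G : ℝ}
    (hF : ∀ m ∈ Finset.Icc 1 τ.M, ‖f m‖ ≤ F) (hG : ∀ m ∈ Finset.Icc 1 τ.M, ‖g m‖ ≤ G)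
    {Q ε : ℝ} (hQ : √((2 * κ + 2) / γ) * (ρ * ∫ s in Ioc 0 T, ω s / s ^ (3 / 2 : ℝ)) = Q)
    (hε : 0 < ε) (hQε : Q * ε ≤ 1 / 2) :
    ∀ m ∈ Finset.Icc 1 τ.M, ‖v m‖ ≤ 2 * (G + F * (1 + Real.log (T / τ.kmin))
      + Q * ((4 * ε * γ)⁻¹ * (γ⁻¹ * G + T * F))) := by
  have hmem1 : 1 ∈ Finset.Icc 1 τ.M := Finset.mem_Icc.2 ⟨le_rfl, τ.M_pos⟩
  have hF0 : 0 ≤ F := (norm_nonneg _).trans (hF 1 hmem1)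
  have hu0 : ‖ι (U 0)‖ ≤ γ⁻¹ * G :=
    (norm_le_inv_mul_of_coercive hγ (hb 1 hmem1) hι (hg 1 hmem1)).trans
      (mul_le_mul_of_nonneg_left (hG 1 hmem1) (inv_nonneg.2 hγ.le))
  have hY : ∀ m ∈ Finset.Icc 1 τ.M, ‖ι (U m)‖ ≤ γ⁻¹ * G + T * F := fun m hm => by
    have hmM := (Finset.mem_Icc.1 hm).2
    have h1 := norm_le_of_energy τ ι b
      (fun m hm u => le_trans (by positivity) (hb m hm u)) hv hstep hF m hmM
    have h2 : τ.t m * F ≤ T * F := by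
      gcongr
      have := τ.t_le_t hmM le_rfl
      rwa [τ.t_last] at this
    linarith
  -- At the index where `‖v‖` is largest, the form-norm bound involves the very quantity being
  -- estimated and can be absorbed.
  obtain ⟨n, hn, hmax⟩ := (Finset.Icc 1 τ.M).exists_max_image (fun m => ‖v m‖) ⟨1, hmem1⟩
  have hR : ∀ m ∈ Finset.Icc 1 τ.M,
      ‖U m‖ ≤ ε * ‖v n‖ + (4 * ε * γ)⁻¹ * (γ⁻¹ * G + T * F) := fun m hm =>
    (norm_le_eps_mul_add hγ (hb m hm) (hv m hm) hε).trans
      (add_le_add (mul_le_mul_of_nonneg_left (hmax m hm) hε.le)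
        (mul_le_mul_of_nonneg_left (hY m hm) (by positivity)))
  have h := norm_le_of_evolution hT τ hω ι b hγ hκ hratio hb hs hρ hdiff hv hstep hg hF hG hR hn
  rw [← mul_assoc (√_), hQ] at h
  exact fun m hm => (hmax m hm).trans (le_of_absorb h (norm_nonneg _) hQε)

theorem final_bound {X B F G L Λ Q γ T : ℝ} (hB : X ≤ 2 * (G + F * (Λ * L) + Q * (γ * G + T * F)))
    (hv : B ≤ X + (F + X)) (hF : 0 ≤ F) (hG : 0 ≤ G) (hL : 1 ≤ L) (hΛ : 0 ≤ Λ) (hQ : 0 ≤ Q)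
    (hγ : 0 ≤ γ) (hT : 0 ≤ T) :
    B ≤ (4 * (1 + Λ + Q * (γ + T)) + 1) * (L * F + G) := by
  have hFL : F ≤ L * F := le_mul_of_one_le_left hF hL
  have h1 : Q * (γ * G + T * F) ≤ Q * ((γ + T) * (L * F + G)) := by
    gcongr
    have e1 : T * F ≤ T * (L * F) := by gcongr
    have e2 : 0 ≤ γ * (L * F) := mul_nonneg hγ (hF.trans hFL)
    have e3 : 0 ≤ T * G := by positivity
    linarith
  have h2 : 0 ≤ Λ * G := by positivity
  linarith

/-- This brings the estimate into the stated form with `μ = 1`: the exponential is at least 1, and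
`1 + T⁻¹` compensates for the factor `T` on the initial term. -/
theorem mul_add_le_exp {C T x y : ℝ} (hC : 0 ≤ C) (hT : 0 < T) (hx : 0 ≤ x) (hy : 0 ≤ y) :
    C * (x + y) ≤ C * (1 + T⁻¹) * Real.exp (1 * T) * (x + 1 * T * y) := by
  have hexp : 1 ≤ Real.exp (1 * T) := Real.one_le_exp (by linarith)
  have h1 : x + y ≤ (1 + T⁻¹) * (x + 1 * T * y) := by
    have e1 : T⁻¹ * (T * y) = y := inv_mul_cancel_left₀ hT.ne' y
    have e2 : 0 ≤ T⁻¹ * x := by positivity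
    have e3 : 0 ≤ T * y := by positivity
    linarith
  have h2 : 0 ≤ (1 + T⁻¹) * (x + 1 * T * y) := by positivity
  calc C * (x + y) ≤ C * ((1 + T⁻¹) * (x + 1 * T * y)) := by gcongr
    _ ≤ C * (Real.exp (1 * T) * ((1 + T⁻¹) * (x + 1 * T * y))) := by
        exact mul_le_mul_of_nonneg_left (le_mul_of_one_le_left h2 hexp) hC
    _ = _ := by ring

/-- The stability estimate with a single constant, separately on each time interval. -/
theorem exists_stability_constant {d : ℕ} (hd : 1 ≤ d) {Ω : Set (E d)}
    (hΩb : Bornology.IsBounded Ω) {T : ℝ} (hT : 0 < T) {ω : ℝ → ℝ} (hω : IsModulus T ω) {α : ℝ}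
    (hα : 0 < α) {a : Fin d → Fin d → ℝ → E d → ℝ} (ha : IsCoeff Ω T α ω a)
    {c β κ : ℝ} (hc : 0 < c) (hβ : 0 < β) (hκ : 0 < κ) :
    ∃ C > 0, ∀ τ : Mesh T, τ.Admissible c β κ →
      ∀ f : ℝ → L2 Ω, MemLp f ∞ (volume.restrict (Ioo 0 T)) →
      ∀ (u₀ : H10 Ω) (g : ℕ → L2 Ω), (∀ m ∈ Finset.Icc 1 τ.M, AvgAEq τ a m u₀ (g m)) →
      ∀ u : ℕ → H10 Ω, IsSolution τ a f (val u₀) u →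
      ∃ v : ℕ → L2 Ω, ∀ m ∈ Finset.Icc 1 τ.M, AvgAEq τ a m (u m) (v m) ∧
        ‖v m‖ + ‖(τ.step m)⁻¹ • jumpBefore (val u₀) u m‖ ≤
          C * (Real.log (T / τ.k) * (eLpNorm f ∞ (volume.restrict (Ioo 0 T))).toReal
            + τ.maxOver (fun m => ‖g m‖)) := by
  obtain ⟨P, hP, hpoin⟩ := exists_poincare hΩb (⟨0, hd⟩ : Fin d)
  have hpoin' : ∀ u : H10 Ω, ‖val u‖ ^ 2 ≤ P * ∑ i, ‖pd i u‖ ^ 2 := fun u =>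
    (hpoin u).trans (mul_le_mul_of_nonneg_left
      (Finset.single_le_sum (f := fun i => ‖pd i u‖ ^ 2) (fun i _ => sq_nonneg _)
        (Finset.mem_univ _)) hP)
  have hγ : 0 < α / (P + 1) := by positivity
  generalize hγdef : α / (P + 1) = γ at hγ
  have hJ : 0 ≤ ∫ s in Ioc 0 T, ω s / s ^ (3 / 2 : ℝ) :=
    setIntegral_nonneg measurableSet_Ioc fun s hs =>
      div_nonneg (hω.nonneg s ⟨hs.1.le, hs.2⟩) (Real.rpow_nonneg hs.1.le _)
  obtain ⟨Q, hQdef⟩ : ∃ Q, √((2 * κ + 2) / γ) *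
    ((d : ℝ) ^ 2 * ∫ s in Ioc 0 T, ω s / s ^ (3 / 2 : ℝ)) = Q := ⟨_, rfl⟩
  have hQ : 0 ≤ Q := hQdef ▸ by positivity
  obtain ⟨ε, hε, hQε⟩ : ∃ ε : ℝ, 0 < ε ∧ Q * ε ≤ 1 / 2 := by
    -- The `+ 1` keeps `ε` defined when `Q = 0`.
    refine ⟨1 / (2 * (Q + 1)), by positivity, ?_⟩
    rw [mul_one_div, div_le_div_iff₀ (by positivity) two_pos]; linarith
  have hCε : 0 < (4 * ε * γ)⁻¹ := by positivity
  have hΛ : 0 ≤ 1 + |(1 - β) * Real.log T - Real.log c| + β := by positivity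
  refine ⟨4 * (1 + (1 + |(1 - β) * Real.log T - Real.log c| + β)
    + Q * (4 * ε * γ)⁻¹ * (γ⁻¹ + T)) + 1, by positivity, ?_⟩
  intro τ hτ f hf u₀ g hg u hu
  obtain ⟨b, hb⟩ := exists_avgForm hω ha hα hP hpoin' τ
  have hbA := fun m hm => (hb m hm).1
  have hbs := fun m hm => (hb m hm).2.1
  have hbc : ∀ m ∈ Finset.Icc 1 τ.M, ∀ u, γ * ‖u‖ ^ 2 ≤ b m u u := fun m hm =>
    hγdef ▸ (hb m hm).2.2.1
  have hbd := fun m hm => (hb m hm).2.2.2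
  set fb := avgRhs τ f
  -- The value `u 0` is arbitrary; putting `u₀` there makes every jump a difference of consecutive
  -- terms.
  let U : ℕ → H10 Ω := fun m => if m = 0 then u₀ else u m
  -- The scheme itself shows `A_{k,m} u_m ∈ L²`: it equals the averaged data minus the jump
  -- quotient.
  let v : ℕ → L2 Ω := fun m => fb m - (τ.step m)⁻¹ • jumpBefore (val u₀) u m
  have hmem1 : 1 ∈ Finset.Icc 1 τ.M := Finset.mem_Icc.2 ⟨le_rfl, τ.M_pos⟩
  have hUm : ∀ m ∈ Finset.Icc 1 τ.M, U m = u m := fun m hm =>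
    if_neg (by have := (Finset.mem_Icc.1 hm).1; omega)
  have hjump : ∀ m ∈ Finset.Icc 1 τ.M, jumpBefore (val u₀) u m =
      valL Ω (U m) - valL Ω (U (m - 1)) := fun m hm => by
    have h1 := (Finset.mem_Icc.1 hm).1
    rw [hUm m hm, valL_apply, valL_apply, jumpBefore]
    by_cases hm1 : m = 1
    · subst hm1; rfl
    · rw [if_neg hm1, show U (m - 1) = u (m - 1) from if_neg (by omega)]
  have hv : ∀ m ∈ Finset.Icc 1 τ.M, ∀ w, b m (U m) w = inner ℝ (v m) (valL Ω w) := by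
    intro m hm w
    have h := hu.step_equation hf hbA hm w
    have hk := (τ.step_pos hm).ne'
    rw [hUm m hm, valL_apply, inner_sub_left, inner_smul_left, RCLike.conj_to_real]
    field_simp
    linarith
  have hstep : ∀ m ∈ Finset.Icc 1 τ.M, τ.step m • v m =
      τ.step m • fb m - (valL Ω (U m) - valL Ω (U (m - 1))) := fun m hm => by
    rw [← hjump m hm, smul_sub, smul_inv_smul₀ (τ.step_pos hm).ne']
  have hF := fun m (hm : m ∈ Finset.Icc 1 τ.M) => norm_avgRhs_le τ hf hm
  have hF0 : 0 ≤ (eLpNorm f ∞ (volume.restrict (Ioo 0 T))).toReal := ENNReal.toReal_nonneg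
  have hG := fun m (hm : m ∈ Finset.Icc 1 τ.M) => τ.le_maxOver (fun m => ‖g m‖) hm
  have hG0 := (norm_nonneg _).trans (hG 1 hmem1)
  have hg' : ∀ m ∈ Finset.Icc 1 τ.M, ∀ w, b m (U 0) w = inner ℝ (g m) (valL Ω w) :=
    fun m hm w => (hbA m hm u₀ w).trans (hg m hm w)
  obtain ⟨hL1, hL⟩ := hτ.log_bounds hT hc
  have hX := norm_le_of_evolution_absorbed hT τ hω (valL Ω) norm_val_le b hγ hκ hτ.ratio hbc hbs
    (sq_nonneg (d : ℝ)) hbd hv hstep hg' hF hG hQdef hε hQε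
  refine ⟨v, fun m hm => ⟨fun w => ?_, ?_⟩⟩
  · rw [← hbA m hm, ← hUm m hm]; exact hv m hm w
  have hjv : ‖(τ.step m)⁻¹ • jumpBefore (val u₀) u m‖ ≤
      (eLpNorm f ∞ (volume.restrict (Ioo 0 T))).toReal + ‖v m‖ := by
    rw [show (τ.step m)⁻¹ • jumpBefore (val u₀) u m = fb m - v m by simp [v]]
    exact (norm_sub_le _ _).trans (add_le_add (hF m hm) le_rfl)
  refine final_bound ?_ (add_le_add le_rfl hjv) hF0 hG0 hL1 hΛ
    (mul_nonneg hQ hCε.le) (inv_nonneg.2 hγ.le) hT.le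
  rw [mul_assoc Q]
  refine (hX m hm).trans ?_
  gcongr

end DG0

end

theorem theorem3p1 {d : ℕ} (hd : 1 ≤ d) (Ω : Set (DG0.E d)) (hΩ : IsOpen Ω)
    (hΩb : Bornology.IsBounded Ω) (T : ℝ) (hT : 0 < T)
    (ω : ℝ → ℝ) (hω : DG0.IsModulus T ω) (α : ℝ) (hα : 0 < α)
    (a : Fin d → Fin d → ℝ → DG0.E d → ℝ) (ha : DG0.IsCoeff Ω T α ω a)
    (c β κ : ℝ) (hc : 0 < c) (hβ : 0 < β) (hκ : 0 < κ) :
    ∃ μ > 0, ∃ δ₀ > 0, ∃ C > 0,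
      ∀ τ : DG0.Mesh T, τ.Admissible c β κ → τ.k - τ.kmin ≤ δ₀ →
      ∀ f : ℝ → DG0.L2 Ω, MemLp f ∞ (volume.restrict (Ioo 0 T)) →
      ∀ (u₀ : DG0.H10 Ω) (g : ℕ → DG0.L2 Ω),
        (∀ m ∈ Finset.Icc 1 τ.M, DG0.AvgAEq τ a m u₀ (g m)) →
      ∀ u : ℕ → DG0.H10 Ω, DG0.IsSolution τ a f (DG0.val u₀) u →
      ∃ v : ℕ → DG0.L2 Ω, (∀ m ∈ Finset.Icc 1 τ.M, DG0.AvgAEq τ a m (u m) (v m)) ∧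
        τ.maxOver (fun m => ‖v m‖ + ‖(τ.step m)⁻¹ • DG0.jumpBefore (DG0.val u₀) u m‖) ≤
          C * Real.exp (μ * T) *
            (Real.log (T / τ.k) * (eLpNorm f ∞ (volume.restrict (Ioo 0 T))).toReal
              + μ * T * τ.maxOver (fun m => ‖g m‖)) := by
  obtain ⟨C, hC, h⟩ := DG0.exists_stability_constant hd hΩb hT hω hα ha hc hβ hκ
  -- The constant may depend on `T`, so `μ = 1` suffices, with `1 + T⁻¹` supplied by
  -- `DG0.mul_add_le_exp`.
  refine ⟨1, one_pos, 1, one_pos, C * (1 + T⁻¹), by positivity, ?_⟩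
  intro τ hτ _ f hf u₀ g hg u hu
  obtain ⟨v, hv⟩ := h τ hτ f hf u₀ g hg u hu
  refine ⟨v, fun m hm => (hv m hm).1, Finset.sup'_le _ _ fun m hm => (hv m hm).2.trans ?_⟩
  have hL := (hτ.log_bounds hT hc).1
  have hG : 0 ≤ τ.maxOver (fun m => ‖g m‖) := (norm_nonneg _).trans
    (τ.le_maxOver (fun m => ‖g m‖) (Finset.mem_Icc.2 ⟨le_rfl, τ.M_pos⟩))
  exact DG0.mul_add_le_exp hC.le hT (mul_nonneg (by linarith) ENNReal.toReal_nonneg) hG
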